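/- Let $\ell_1,\dots,\ell_n:\mathbb{R}^d\times Z\to\mathbb{R}$ ($n\ge 1$) be losses, twice differentiable in the first argument, let $\mathbf D_1,\dots,\mathbf D_n$ be probability distributions on $Z$, let $\mathcal L_i(\mathbf w)=\mathbb E_{\mathbf z\sim\mathbf D_i}[\ell_i(\mathbf w;\mathbf z)]$, and let $F(\mathbf w)=\frac1n\sum_{i=1}^n\mathcal L_i(\mathbf w-\alpha\nabla\mathcal L_i(\mathbf w))$ with $\alpha>0$. Assume that for all $i$ and all $\mathbf w,\mathbf w'\in\mathbb{R}^d$: - $\mathcal L_i$ is $C^2$, $\|\nabla\mathcal L_i(\mathbf w)-\nabla\mathcal L_i(\mathbf w')\|\le L\|\mathbf w-\mathbf w'\|$ and $\|\nabla^2\mathcal L_i(\mathbf w)-\nabla^2\mathcal L_i(\mathbf w')\|\le\rho\|\mathbf w-\mathbf w'\|$ (spectral norm); - $\nabla\ell_i(\mathbf w;\mathbf z)$ and $\nabla^2\ell_i(\mathbf w;\mathbf z)$, $\mathbf z\sim\mathbf D_i$, are unbiased for $\nabla\mathcal L_i(\mathbf w)$ and $\nabla^2\mathcal L_i(\mathbf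 w)$, with $\mathbb E\|\nabla\ell_i(\mathbf w;\mathbf z)-\nabla\mathcal L_i(\mathbf w)\|^2\le\sigma_G^2$ and $\mathbb E\|\nabla^2\ell_i(\mathbf w;\mathbf z)-\nabla^2\mathcal L_i(\mathbf w)\|^2\le\sigma_H^2$; - $F$ is bounded below, and $\|\nabla\mathcal L_i(\mathbf w)\|\le G$. Given $\mathbf w_0\in\mathbb{R}^d$, the algorithm $\mathrm{MOML}^{\mathrm{v1}}$ with task batch size $B$, data batch size $K$, step size $\eta$ and momentum factor $\beta$ does the following for $t=0,\dots,T-1$. It draws a set $\mathcal B_t$ of $B$ tasks uniformly at random and, for every $i\in\mathcal B_t$, three batches $\mathcal S_1^i,\mathcal S_2^i,\mathcal S_3^i$ of $K$ samples from $\mathbf D_i$, all draws being independent of each other and of the past. With $\widehat\nabla_{\mathcal S}\mathcal L_i=\frac1K\sum_{\mathbf z\in\mathcal S}\nabla\ell_i(\cdot;\mathbf z)$ and $\widehat\nabla^2_{\mathcal S}\mathcal L_i=\frac1K\sum_{\mathbf z\in\mathcal S}\nabla^2\ell_i(\cdot;\mathbf z)$, it sets $\widehat{\mathbf v}_t^i=\mathbf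 w_t-\alpha\widehat\nabla_{\mathcal S_1^i}\mathcal L_i(\mathbf w_t)$ for $i\in\mathcal B_t$; $$\mathbf u_{t+1}^i=(1-\beta)\mathbf u_t^i+\beta\widehat{\mathbf v}_t^i\quad(i\in\mathcal B_t),\qquad \mathbf u_{t+1}^i=\mathbf u_t^i\quad(i\notin\mathcal B_t),$$ except that $\mathbf u_{t+1}^i=\widehat{\mathbf v}_t^i$ if $t$ is the first iteration in which task $i$ is sampled (this initializes $\mathbf u^i$); and $$\mathbf w_{t+1}=\mathbf w_t-\eta\,\frac1B\sum_{i\in\mathcal B_t}\bigl(I-\alpha\widehat\nabla^2_{\mathcal S_2^i}\mathcal L_i(\mathbf w_t)\bigr)\widehat\nabla_{\mathcal S_3^i}\mathcal L_i(\mathbf u_{t+1}^i).$$ **Theorem.** For all $\alpha,G>0$ and $L,\rho,\sigma_G,\sigma_H,\Delta_0\ge0$ there is a constant $C>0$, depending only on these numbers (in particular neither on $n$, $d$, the losses and the distributions, nor on $\epsilon$ and $T$), such that the following holds for all $n\ge1$, $\epsilon>0$ and all integers $T\ge C\,n\,\epsilon^{-5}$. Let $B=K=1$, $\eta=\frac{B^{2/5}}{n^{2/5}T^{3/5}}$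 and $\beta=\frac{n^{2/5}}{B^{2/5}T^{2/5}}$. If $\epsilon\le1$, then $\beta<1$. Whenever $\beta<1$, for all losses, distributions and $\mathbf w_0$ as above with $F(\mathbf w_0)-\inf F\le\Delta_0$, the iterates of $\mathrm{MOML}^{\mathrm{v1}}$ satisfy $$\mathbb E\,\|\nabla F(\mathbf w_\tau)\|\le\epsilon,$$ where $\tau$ is uniform on $\{0,\dots,T-1\}$ and independent of the algorithm's randomness. That is, $\mathrm{MOML}^{\mathrm{v1}}$ with these parameters finds an $\epsilon$-stationary point in $T=\mathcal O(n\epsilon^{-5})$ iterations. -/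

import Mathlib

open MeasureTheory ProbabilityTheory
open scoped Gradient

noncomputable section

namespace MOML

/-- The parameter space `ℝ^d` with the Euclidean norm. -/
abbrev Vec (d : ℕ) := EuclideanSpace ℝ (Fin d)

/-- The Hessian of `f` at `w`, as an operator on `ℝ^d`; its operator norm is the spectral norm. -/
def hess {d : ℕ} (f : Vec d → ℝ) (w : Vec d) : Vec d →L[ℝ] Vec d :=
  fderiv ℝ (∇ f) w

section Objective

variable {d n : ℕ} {Z : Type*} [MeasurableSpace Z]

/-- The risk of task `i`: `𝓛ᵢ(w) = 𝔼_{z ∼ Dᵢ} ℓᵢ(w; z)`. -/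
def risk (ℓ : Fin n → Vec d → Z → ℝ) (D : Fin n → Measure Z) (i : Fin n) (w : Vec d) : ℝ :=
  ∫ z, ℓ i w z ∂(D i)

/-- The MAML objective `F(w) = (1/n) ∑ᵢ 𝓛ᵢ(w - α ∇𝓛ᵢ(w))`. -/
def metaObjective (α : ℝ) (ℓ : Fin n → Vec d → Z → ℝ) (D : Fin n → Measure Z) (w : Vec d) : ℝ :=
  (n : ℝ)⁻¹ * ∑ i, risk ℓ D i (w - α • ∇ (risk ℓ D i) w)

/-- The standing assumptions on the losses `ℓᵢ` and the data distributions `Dᵢ`. -/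
structure Assumptions (α L ρ G σG σH : ℝ) (ℓ : Fin n → Vec d → Z → ℝ)
    (D : Fin n → Measure Z) : Prop where
  /-- The losses are twice differentiable in the parameter, and the stochastic gradients and
  Hessians are measurable. -/
  loss_diff : ∀ i z, Differentiable ℝ (fun w => ℓ i w z)
  loss_grad_diff : ∀ i z, Differentiable ℝ (∇ (fun w => ℓ i w z))
  grad_measurable : ∀ i, Measurable (fun p : Vec d × Z => ∇ (fun w => ℓ i w p.2) p.1)
  hess_measurable : ∀ i, Measurable (fun p : Vec d × Z => hess (fun w => ℓ i w p.2) p.1)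
  /-- The risks are well defined, and stochastic gradients and Hessians are unbiased. -/
  loss_integrable : ∀ i w, Integrable (fun z => ℓ i w z) (D i)
  grad_unbiased : ∀ i w, ∫ z, ∇ (fun w' => ℓ i w' z) w ∂(D i) = ∇ (risk ℓ D i) w
  hess_unbiased : ∀ i w, ∫ z, hess (fun w' => ℓ i w' z) w ∂(D i) = hess (risk ℓ D i) w
  /-- Smoothness of the risks. -/
  risk_contDiff : ∀ i, ContDiff ℝ 2 (risk ℓ D i)
  grad_lipschitz : ∀ i w w', ‖∇ (risk ℓ D i) w - ∇ (risk ℓ D i) w'‖ ≤ L * ‖w - w'‖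
  hess_lipschitz : ∀ i w w', ‖hess (risk ℓ D i) w - hess (risk ℓ D i) w'‖ ≤ ρ * ‖w - w'‖
  /-- Bounded variance. -/
  grad_sq_integrable : ∀ i w,
    Integrable (fun z => ‖∇ (fun w' => ℓ i w' z) w - ∇ (risk ℓ D i) w‖ ^ 2) (D i)
  grad_variance : ∀ i w,
    ∫ z, ‖∇ (fun w' => ℓ i w' z) w - ∇ (risk ℓ D i) w‖ ^ 2 ∂(D i) ≤ σG ^ 2
  hess_sq_integrable : ∀ i w,
    Integrable (fun z => ‖hess (fun w' => ℓ i w' z) w - hess (risk ℓ D i) w‖ ^ 2) (D i)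
  hess_variance : ∀ i w,
    ∫ z, ‖hess (fun w' => ℓ i w' z) w - hess (risk ℓ D i) w‖ ^ 2 ∂(D i) ≤ σH ^ 2
  /-- `F` is bounded below. -/
  bddBelow : BddBelow (Set.range (metaObjective α ℓ D))
  /-- Bounded gradients. -/
  grad_bounded : ∀ i w, ‖∇ (risk ℓ D i) w‖ ≤ G

end Objective

section Sampling

/-- A batch of `B` distinct tasks among `n`. -/
def TaskBatch (n B : ℕ) : Type := {s : Finset (Fin n) // s.card = B}

instance (n B : ℕ) : MeasurableSpace (TaskBatch n B) := ⊤

/-- `K` data points for each of the `n` tasks. The algorithm below reads only those of the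
sampled tasks. -/
abbrev DataBatch (n K : ℕ) (Z : Type*) := Fin n → Fin K → Z

/-- The randomness of one iteration: the task batch `𝓑ₜ` and the data batches `𝓢₁, 𝓢₂, 𝓢₃`. -/
abbrev StepSample (n B K : ℕ) (Z : Type*) :=
  TaskBatch n B × DataBatch n K Z × DataBatch n K Z × DataBatch n K Z

/-- The law of a data batch: independent points, those of task `i` distributed as `Dᵢ`. -/
def dataLaw {n : ℕ} (K : ℕ) {Z : Type*} [MeasurableSpace Z] (D : Fin n → Measure Z) :
    Measure (DataBatch n K Z) :=
  Measure.pi fun i => Measure.pi fun _ => D i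

/-- The law of the randomness of one iteration: `𝓑ₜ` is uniform among the sets of `B` tasks, and
`𝓑ₜ, 𝓢₁, 𝓢₂, 𝓢₃` are independent. -/
def stepLaw {n : ℕ} (B K : ℕ) {Z : Type*} [MeasurableSpace Z] (D : Fin n → Measure Z) :
    Measure (StepSample n B K Z) :=
  (uniformOn (Set.univ : Set (TaskBatch n B))).prod
    ((dataLaw K D).prod ((dataLaw K D).prod (dataLaw K D)))

end Sampling

section Algorithm

variable {d n B K : ℕ} {Z : Type*}

/-- The mini-batch gradient of a loss. -/
def batchGrad (f : Vec d → Z → ℝ) (S : Fin K → Z) (w : Vec d) : Vec d :=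
  (K : ℝ)⁻¹ • ∑ k, ∇ (fun w' => f w' (S k)) w

/-- The mini-batch Hessian of a loss. -/
def batchHess (f : Vec d → Z → ℝ) (S : Fin K → Z) (w : Vec d) : Vec d →L[ℝ] Vec d :=
  (K : ℝ)⁻¹ • ∑ k, hess (fun w' => f w' (S k)) w

/-- The state of the algorithm: the meta-model `w`, the personalized models `uⁱ`, and the set of
the tasks that have been sampled so far. -/
structure State (d n : ℕ) where
  w : Vec d
  u : Fin n → Vec d
  seen : Finset (Fin n)

/-- The update of the personalized models. A sampled task makes the momentum step
`uⁱ ← (1 - β) uⁱ + β v̂ⁱ` with `v̂ⁱ = w - α ∇̂_{𝓢₁} 𝓛ᵢ(w)`, except that its personalized model is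
initialized as `uⁱ ← v̂ⁱ` when the task is sampled for the first time. The other tasks are left
untouched. -/
def updateU (α β : ℝ) (ℓ : Fin n → Vec d → Z → ℝ) (s : State d n) (b : TaskBatch n B)
    (S₁ : DataBatch n K Z) (i : Fin n) : Vec d :=
  if i ∈ b.1 then
    if i ∈ s.seen then
      (1 - β) • s.u i + β • (s.w - α • batchGrad (ℓ i) (S₁ i) s.w)
    else s.w - α • batchGrad (ℓ i) (S₁ i) s.w
  else s.u i

/-- The stochastic meta-gradient
`Δ̂ = (1/B) ∑_{i ∈ 𝓑} (I - α ∇̂²_{𝓢₂} 𝓛ᵢ(w)) ∇̂_{𝓢₃} 𝓛ᵢ(uⁱ)`, where `u` are the updated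
personalized models. -/
def metaGrad (α : ℝ) (ℓ : Fin n → Vec d → Z → ℝ) (w : Vec d) (u : Fin n → Vec d)
    (b : TaskBatch n B) (S₂ S₃ : DataBatch n K Z) : Vec d :=
  (B : ℝ)⁻¹ • ∑ i ∈ b.1,
    (ContinuousLinearMap.id ℝ (Vec d) - α • batchHess (ℓ i) (S₂ i) w)
      (batchGrad (ℓ i) (S₃ i) (u i))

/-- One iteration. -/
def step (α η β : ℝ) (ℓ : Fin n → Vec d → Z → ℝ) (s : State d n) (x : StepSample n B K Z) :
    State d n where
  w := s.w - η • metaGrad α ℓ s.w (updateU α β ℓ s x.1 x.2.1) x.1 x.2.2.1 x.2.2.2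
  u := updateU α β ℓ s x.1 x.2.1
  seen := s.seen ∪ x.1.1

/-- The state before iteration `t`, when the algorithm starts from `w₀` and the randomness of the
iterations is `x`. The initial value `0` of the personalized models is never read. -/
def run (α η β : ℝ) (ℓ : Fin n → Vec d → Z → ℝ) (w₀ : Vec d) (x : ℕ → StepSample n B K Z) :
    ℕ → State d n
  | 0 => ⟨w₀, 0, ∅⟩
  | t + 1 => step α η β ℓ (run α η β ℓ w₀ x t) (x t)

/-- The step size `η = B^{2/5} / (n^{2/5} T^{3/5})`. -/
def stepSize (B n T : ℕ) : ℝ :=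
  (B : ℝ) ^ (2 / 5 : ℝ) / ((n : ℝ) ^ (2 / 5 : ℝ) * (T : ℝ) ^ (3 / 5 : ℝ))

/-- The momentum factor `β = n^{2/5} / (B^{2/5} T^{2/5})`. -/
def momentum (B n T : ℕ) : ℝ :=
  (n : ℝ) ^ (2 / 5 : ℝ) / ((B : ℝ) ^ (2 / 5 : ℝ) * (T : ℝ) ^ (2 / 5 : ℝ))

end Algorithm

end MOML

end

/-! Write `vᵢ(w) = w - α∇𝓛ᵢ(w)`. If the sampled task used `vᵢ(w)` in place of its personalized
model, the meta-gradient would be unbiased for `∇F(w)`; in general its bias is at most `(1 + αL) L`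
times the distance from the updated model to `vᵢ(w)`. The proof controls this distance through a
Lyapunov function, the optimality gap of `F` plus `A` times the sum over all tasks of the squared
distances `‖uⁱ - vᵢ(w)‖²` (`potential`).

One iteration has three effects. The descent inequality for `F`, whose gradient is Lipschitz, gains
`η/2 ‖∇F‖²` on average over the task, up to the bias and a term of order `η²`. The momentum step
multiplies the error of the sampled task by `1 - β`, hence the total error by about `1 - β/n` on
average, and adds `β²α²σG²` of noise. Finally the motion of `w` displaces all `n` adapted models;
Young's inequality with weight `c` charges this as a factor `1 + c` and a term of order `n η²/c`.

With `K = ((1 + αL) L)²`, the bias costs `ηK/2` per unit of error of the sampled task. Choosing `c =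
β/(2n)` leaves half of the contraction to pay for it, which dictates `A = ηK/β`. In terms of `r =
(n/T)^{1/5}` one has `β = r²`, `η = r³/n`, `A = rK/n`, and every noise term is `O(η r²)` uniformly
in `n` (`drift_coefficient_le`, `drift_constant_le`). Summing over `T` iterations and using `T η r²
= 1`, the initial potential divided by `T` is also `O(η r²)`. Hence the mean squared gradient is
`O(r²)`, the mean norm is `O(r)`, and `T ≥ C n ε⁻⁵` makes it at most `ε`.

The carrying lemmas are `Assumptions.le_integral_inner_sampledGrad` (bias),
`Assumptions.integral_sampledModel_sub_sq_le` (contraction),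
`Assumptions.average_lintegral_potential_add_le` (drift) and `Assumptions.sum_lintegral_run_le`
(telescoping). -/

noncomputable section

namespace MOML

/-! ### Calculus of one adapted risk. -/

section Calculus

variable {d : ℕ} {f : Vec d → ℝ} {α L ρ G : ℝ}

/-- The adapted model `w - α ∇f(w)`. -/
def adapted (α : ℝ) (f : Vec d → ℝ) (w : Vec d) : Vec d := w - α • ∇ f w

/-- The gradient `(I - α ∇²f(w)) ∇f(w - α ∇f(w))` of `w ↦ f (w - α ∇f(w))`. -/
def adaptedGrad (α : ℝ) (f : Vec d → ℝ) (w : Vec d) : Vec d :=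
  (ContinuousLinearMap.id ℝ (Vec d) - α • hess f w) (∇ f (adapted α f w))

theorem contDiff_gradient (hf : ContDiff ℝ 2 f) : ContDiff ℝ 1 (∇ f) := by
  have h : ContDiff ℝ 1 (fderiv ℝ f) := hf.fderiv_right (by norm_num)
  exact (InnerProductSpace.toDual ℝ (Vec d)).symm.contDiff.comp h

theorem hasFDerivAt_gradient (hf : ContDiff ℝ 2 f) (w : Vec d) :
    HasFDerivAt (∇ f) (hess f w) w :=
  ((contDiff_gradient hf).differentiable (by norm_num) w).hasFDerivAt

theorem continuous_hess (hf : ContDiff ℝ 2 f) : Continuous (hess f) :=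
  (contDiff_gradient hf).continuous_fderiv (by norm_num)

theorem inner_hess_left (hf : ContDiff ℝ 2 f) (w x y : Vec d) :
    inner ℝ (hess f w x) y = fderiv ℝ (fderiv ℝ f) w x y := by
  have h1 : HasFDerivAt (fun w' => inner ℝ (∇ f w') y)
      ((fderivInnerCLM ℝ (∇ f w, y)).comp ((hess f w).prod 0)) w :=
    (hasFDerivAt_gradient hf w).inner ℝ (hasFDerivAt_const y w)
  have h2 : HasFDerivAt (fderiv ℝ f) (fderiv ℝ (fderiv ℝ f) w) w :=
    ((hf.fderiv_right (m := 1) (by norm_num)).differentiable (by norm_num) w).hasFDerivAt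
  have h3 : HasFDerivAt (fun w' => fderiv ℝ f w' y)
      ((fderiv ℝ (fderiv ℝ f) w).flip y) w := by
    simpa using h2.clm_apply (hasFDerivAt_const y w)
  have h4 : (fun w' => inner ℝ (∇ f w') y) = fun w' => fderiv ℝ f w' y := by
    funext w'
    exact inner_gradient_left
  rw [h4] at h1
  have h5 := congrArg (fun φ : Vec d →L[ℝ] ℝ => φ x) (h1.unique h3)
  simpa [fderivInnerCLM_apply] using h5

/-- Symmetry is what lets the chain rule for `f ∘ adapted` produce `I - α∇²f` itself rather than its
adjoint. -/
theorem hess_symmetric (hf : ContDiff ℝ 2 f) (w x y : Vec d) :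
    inner ℝ (hess f w x) y = inner ℝ x (hess f w y) := by
  rw [real_inner_comm (hess f w y) x, inner_hess_left hf, inner_hess_left hf]
  exact (hf.contDiffAt.isSymmSndFDerivAt (by simp)) x y

theorem norm_hess_le (hL : 0 ≤ L) (hgrad : ∀ w w', ‖∇ f w - ∇ f w'‖ ≤ L * ‖w - w'‖) (w : Vec d) :
    ‖hess f w‖ ≤ L := by
  have h : LipschitzWith L.toNNReal (∇ f) := by
    refine LipschitzWith.of_dist_le_mul fun x y => ?_
    rw [dist_eq_norm, dist_eq_norm, Real.coe_toNNReal _ hL]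
    exact hgrad x y
  simpa [hess, Real.coe_toNNReal _ hL] using norm_fderiv_le_of_lipschitz ℝ (x₀ := w) h

theorem norm_id_sub_hess_le (hα : 0 < α) (hL : 0 ≤ L)
    (hgrad : ∀ w w', ‖∇ f w - ∇ f w'‖ ≤ L * ‖w - w'‖) (w : Vec d) :
    ‖ContinuousLinearMap.id ℝ (Vec d) - α • hess f w‖ ≤ 1 + α * L := by
  refine (norm_sub_le _ _).trans (add_le_add ContinuousLinearMap.norm_id_le ?_)
  rw [norm_smul, Real.norm_of_nonneg hα.le]
  exact mul_le_mul_of_nonneg_left (norm_hess_le hL hgrad w) hα.le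

theorem norm_adapted_sub_le (hα : 0 < α)
    (hgrad : ∀ w w', ‖∇ f w - ∇ f w'‖ ≤ L * ‖w - w'‖) (w w' : Vec d) :
    ‖adapted α f w - adapted α f w'‖ ≤ (1 + α * L) * ‖w - w'‖ := by
  have h : adapted α f w - adapted α f w' = (w - w') - α • (∇ f w - ∇ f w') := by
    simp only [adapted, smul_sub]; abel
  rw [h]
  refine (norm_sub_le _ _).trans ?_
  rw [norm_smul, Real.norm_of_nonneg hα.le]
  nlinarith [mul_le_mul_of_nonneg_left (hgrad w w') hα.le]

theorem hasGradientAt_comp_adapted (hf : ContDiff ℝ 2 f) (w : Vec d) :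
    HasGradientAt (fun w' => f (adapted α f w')) (adaptedGrad α f w) w := by
  rw [hasGradientAt_iff_hasFDerivAt]
  have h1 : HasFDerivAt (adapted α f) (ContinuousLinearMap.id ℝ (Vec d) - α • hess f w) w :=
    (hasFDerivAt_id w).sub ((hasFDerivAt_gradient hf w).const_smul α)
  have h2 : HasFDerivAt f (fderiv ℝ f (adapted α f w)) (adapted α f w) :=
    (hf.differentiable (by norm_num) _).hasFDerivAt
  refine (h2.comp w h1).congr_fderiv (ContinuousLinearMap.ext fun x => ?_)
  rw [InnerProductSpace.toDual_apply_apply, ContinuousLinearMap.comp_apply,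
    ← inner_gradient_left (𝕜 := ℝ)]
  simp only [adaptedGrad, sub_apply, smul_apply,
    ContinuousLinearMap.id_apply, inner_sub_left, inner_sub_right, real_inner_smul_left,
    real_inner_smul_right, hess_symmetric hf]

theorem continuous_adapted (hf : ContDiff ℝ 2 f) : Continuous (adapted α f) :=
  continuous_id.sub ((contDiff_gradient hf).continuous.const_smul α)

theorem continuous_adaptedGrad (hf : ContDiff ℝ 2 f) : Continuous (adaptedGrad α f) :=
  (continuous_const.sub ((continuous_hess hf).const_smul α)).clm_apply
    ((contDiff_gradient hf).continuous.comp (continuous_adapted hf))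

/-- The difference of two products is split so that one factor varies at a time. The bound `G`
enters because the variation of the Hessian is multiplied by a gradient. -/
theorem norm_adaptedGrad_sub_le (hα : 0 < α) (hL : 0 ≤ L)
    (hgrad : ∀ w w', ‖∇ f w - ∇ f w'‖ ≤ L * ‖w - w'‖)
    (hhess : ∀ w w', ‖hess f w - hess f w'‖ ≤ ρ * ‖w - w'‖) (hbdd : ∀ w, ‖∇ f w‖ ≤ G)
    (w w' : Vec d) :
    ‖adaptedGrad α f w - adaptedGrad α f w'‖
      ≤ ((1 + α * L) ^ 2 * L + α * ρ * G) * ‖w - w'‖ := by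
  have h : adaptedGrad α f w - adaptedGrad α f w' =
      (ContinuousLinearMap.id ℝ (Vec d) - α • hess f w)
        (∇ f (adapted α f w) - ∇ f (adapted α f w')) -
      (α • (hess f w - hess f w')) (∇ f (adapted α f w')) := by
    simp only [adaptedGrad, map_sub, sub_apply, smul_apply,
      ContinuousLinearMap.id_apply, smul_sub]
    abel
  have hk : 0 ≤ 1 + α * L := by positivity
  rw [h]
  have h1 : ‖(ContinuousLinearMap.id ℝ (Vec d) - α • hess f w)
      (∇ f (adapted α f w) - ∇ f (adapted α f w'))‖
      ≤ (1 + α * L) * (L * ((1 + α * L) * ‖w - w'‖)) :=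
    (ContinuousLinearMap.le_of_opNorm_le _ (norm_id_sub_hess_le hα hL hgrad w) _).trans
      (mul_le_mul_of_nonneg_left ((hgrad _ _).trans
        (mul_le_mul_of_nonneg_left (norm_adapted_sub_le hα hgrad w w') hL)) hk)
  have h2 : ‖(α • (hess f w - hess f w')) (∇ f (adapted α f w'))‖
      ≤ (α * (ρ * ‖w - w'‖)) * G := by
    have hn : ‖α • (hess f w - hess f w')‖ ≤ α * (ρ * ‖w - w'‖) := by
      rw [norm_smul, Real.norm_of_nonneg hα.le]
      exact mul_le_mul_of_nonneg_left (hhess w w') hα.le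
    exact (ContinuousLinearMap.le_of_opNorm_le _ hn _).trans
      (mul_le_mul_of_nonneg_left (hbdd _) ((norm_nonneg _).trans hn))
  refine (norm_sub_le _ _).trans ((add_le_add h1 h2).trans_eq ?_)
  ring

/-- The descent inequality, with the constant of the mean value theorem. -/
theorem le_add_inner_add_of_lipschitz_gradient {F : Vec d → ℝ} {g : Vec d → Vec d} {K : ℝ}
    (hK : 0 ≤ K) (hF : ∀ w, HasGradientAt F (g w) w)
    (hg : ∀ w w', ‖g w - g w'‖ ≤ K * ‖w - w'‖) (w w' : Vec d) :
    F w' ≤ F w + inner ℝ (g w) (w' - w) + K * ‖w' - w‖ ^ 2 := by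
  obtain ⟨z, hz, h⟩ := domain_mvt (s := Set.univ) (x := w) (y := w')
    (fun x _ => (hF x).hasFDerivAt.hasFDerivWithinAt) convex_univ trivial trivial
  rw [InnerProductSpace.toDual_apply_apply] at h
  have hzw : ‖z - w‖ ≤ ‖w' - w‖ := norm_sub_le_of_mem_segment hz
  have h1 : inner ℝ (g z - g w) (w' - w) ≤ K * ‖w' - w‖ * ‖w' - w‖ :=
    (real_inner_le_norm _ _).trans (mul_le_mul_of_nonneg_right
      ((hg z w).trans (mul_le_mul_of_nonneg_left hzw hK)) (norm_nonneg _))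
  rw [inner_sub_left] at h1
  nlinarith

end Calculus

/-! ### Smoothness of the meta-objective. -/

section Objective

variable {d n : ℕ} {Z : Type*} [MeasurableSpace Z] {α L ρ G σG σH : ℝ}
  {ℓ : Fin n → Vec d → Z → ℝ} {D : Fin n → Measure Z}

/-- The average of the gradients of the adapted risks. -/
def metaObjectiveGrad (α : ℝ) (ℓ : Fin n → Vec d → Z → ℝ) (D : Fin n → Measure Z) (w : Vec d) :
    Vec d :=
  (n : ℝ)⁻¹ • ∑ i, adaptedGrad α (risk ℓ D i) w

theorem Assumptions.hasGradientAt_metaObjective (h : Assumptions α L ρ G σG σH ℓ D) (w : Vec d) :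
    HasGradientAt (metaObjective α ℓ D) (metaObjectiveGrad α ℓ D w) w := by
  rw [hasGradientAt_iff_hasFDerivAt, metaObjectiveGrad, map_smul, map_sum]
  have h1 : HasFDerivAt (fun w' => ∑ i, risk ℓ D i (adapted α (risk ℓ D i) w'))
      (∑ i, InnerProductSpace.toDual ℝ (Vec d) (adaptedGrad α (risk ℓ D i) w)) w :=
    HasFDerivAt.fun_sum fun i _ =>
      (hasGradientAt_comp_adapted (h.risk_contDiff i) w).hasFDerivAt
  exact h1.const_mul (n : ℝ)⁻¹

theorem Assumptions.gradient_metaObjective (h : Assumptions α L ρ G σG σH ℓ D) :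
    ∇ (metaObjective α ℓ D) = metaObjectiveGrad α ℓ D :=
  funext fun w => (h.hasGradientAt_metaObjective w).gradient

theorem Assumptions.norm_metaObjectiveGrad_sub_le (h : Assumptions α L ρ G σG σH ℓ D)
    (hn : 0 < n) (hα : 0 < α) (hL : 0 ≤ L) (w w' : Vec d) :
    ‖metaObjectiveGrad α ℓ D w - metaObjectiveGrad α ℓ D w'‖
      ≤ ((1 + α * L) ^ 2 * L + α * ρ * G) * ‖w - w'‖ := by
  have hn' : (0 : ℝ) < n := Nat.cast_pos.mpr hn
  rw [metaObjectiveGrad, metaObjectiveGrad, ← smul_sub, ← Finset.sum_sub_distrib, norm_smul,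
    norm_inv, Real.norm_of_nonneg hn'.le, inv_mul_le_iff₀ hn']
  refine (norm_sum_le_of_le _ fun i _ => norm_adaptedGrad_sub_le hα hL (h.grad_lipschitz i)
    (h.hess_lipschitz i) (h.grad_bounded i) w w').trans_eq ?_
  simp

theorem Assumptions.continuous_metaObjective (h : Assumptions α L ρ G σG σH ℓ D) :
    Continuous (metaObjective α ℓ D) :=
  continuous_iff_continuousAt.mpr fun w => (h.hasGradientAt_metaObjective w).continuousAt

theorem Assumptions.continuous_metaObjectiveGrad (h : Assumptions α L ρ G σG σH ℓ D) :
    Continuous (metaObjectiveGrad α ℓ D) := by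
  have h1 : Continuous fun w => ∑ i, adaptedGrad α (risk ℓ D i) w :=
    continuous_finsetSum _ fun i _ => continuous_adaptedGrad (h.risk_contDiff i)
  exact h1.const_smul (n : ℝ)⁻¹

theorem Assumptions.metaObjective_descent (h : Assumptions α L ρ G σG σH ℓ D)
    (hn : 0 < n) (hα : 0 < α) (hL : 0 ≤ L) (hρ : 0 ≤ ρ) (hG : 0 < G) (w w' : Vec d) :
    metaObjective α ℓ D w' ≤ metaObjective α ℓ D w
      + inner ℝ (metaObjectiveGrad α ℓ D w) (w' - w)
      + ((1 + α * L) ^ 2 * L + α * ρ * G) * ‖w' - w‖ ^ 2 :=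
  le_add_inner_add_of_lipschitz_gradient (by positivity) h.hasGradientAt_metaObjective
    (h.norm_metaObjectiveGrad_sub_le hn hα hL) w w'

end Objective

/-! ### Second moments of random vectors. -/

section Moments

/-- Used where the first data point determines the personalized model and the moment bound is
uniform over all such models. -/
theorem integrable_prod_of_forall_integral_le {X Y : Type*} [MeasurableSpace X]
    [MeasurableSpace Y] {μ : Measure X} {ν : Measure Y} [IsProbabilityMeasure μ] [SFinite ν]
    {f : X × Y → ℝ} {M : ℝ} (hf : AEStronglyMeasurable f (μ.prod ν)) (hf₀ : ∀ p, 0 ≤ f p)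
    (hint : ∀ x, Integrable (fun y => f (x, y)) ν) (hM : ∀ x, ∫ y, f (x, y) ∂ν ≤ M) :
    Integrable f (μ.prod ν) ∧ ∫ p, f p ∂(μ.prod ν) ≤ M := by
  have h : Integrable f (μ.prod ν) := by
    rw [integrable_prod_iff hf]
    refine ⟨Filter.Eventually.of_forall hint,
      Integrable.of_bound hf.norm.integral_prod_right' M (Filter.Eventually.of_forall fun x => ?_)⟩
    simp only [Real.norm_of_nonneg (hf₀ _)]
    rw [Real.norm_of_nonneg (integral_nonneg fun y => hf₀ _)]
    exact hM x
  refine ⟨h, ?_⟩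
  rw [integral_prod _ h]
  calc ∫ x, ∫ y, f (x, y) ∂ν ∂μ ≤ ∫ _, M ∂μ :=
        integral_mono h.integral_prod_left (integrable_const M) hM
    _ = M := by simp

variable {Z E : Type*} [MeasurableSpace Z] {μ : Measure Z} [IsProbabilityMeasure μ]
  [NormedAddCommGroup E]

theorem integrable_of_integrable_norm_sub_sq {X : Z → E} {m : E} (hX : AEStronglyMeasurable X μ)
    (hint : Integrable (fun z => ‖X z - m‖ ^ 2) μ) : Integrable X μ := by
  have h : MemLp (fun z => X z - m) 2 μ :=
    (memLp_two_iff_integrable_sq_norm (hX.sub aestronglyMeasurable_const)).mpr hint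
  exact ((h.integrable (by norm_num)).add (integrable_const m)).congr
    (Filter.Eventually.of_forall fun z => by simp)

/-- The factor 2 comes from the triangle inequality: this is also applied to Hessians in operator
norm, where no orthogonal decomposition of the variance is available. -/
theorem integral_norm_sq_le_of_integral_norm_sub_sq_le {X : Z → E} {m : E} {a b : ℝ}
    (hX : AEStronglyMeasurable X μ) (hint : Integrable (fun z => ‖X z - m‖ ^ 2) μ)
    (hm : ‖m‖ ≤ a) (hvar : ∫ z, ‖X z - m‖ ^ 2 ∂μ ≤ b) :
    Integrable (fun z => ‖X z‖ ^ 2) μ ∧ ∫ z, ‖X z‖ ^ 2 ∂μ ≤ 2 * (a ^ 2 + b) := by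
  have hle : ∀ z, ‖X z‖ ^ 2 ≤ 2 * ‖X z - m‖ ^ 2 + 2 * a ^ 2 := fun z => by
    have h1 : ‖X z‖ ≤ ‖X z - m‖ + a := by
      linarith [norm_sub_norm_le (X z) m]
    nlinarith [norm_nonneg (X z), sq_nonneg (‖X z - m‖ - a)]
  have hbound : Integrable (fun z => 2 * ‖X z - m‖ ^ 2 + 2 * a ^ 2) μ :=
    (hint.const_mul 2).add (integrable_const _)
  have h : Integrable (fun z => ‖X z‖ ^ 2) μ :=
    hbound.mono' (hX.norm.pow 2) (Filter.Eventually.of_forall fun z => by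
      rw [Real.norm_of_nonneg (by positivity)]; exact hle z)
  refine ⟨h, (integral_mono h hbound hle).trans ?_⟩
  rw [integral_add (hint.const_mul 2) (integrable_const _), integral_const_mul]
  simp only [integral_const, probReal_univ, one_smul]
  linarith

/-- The cross term has mean zero. This exact identity keeps the noise of a momentum step at order
`β²`. -/
theorem integral_norm_add_smul_centered_sq [InnerProductSpace ℝ E] [CompleteSpace E]
    {X : Z → E} {m : E} (hX : AEStronglyMeasurable X μ)
    (hint : Integrable (fun z => ‖X z - m‖ ^ 2) μ) (hm : ∫ z, X z ∂μ = m) (a : E) (c : ℝ) :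
    Integrable (fun z => ‖a + c • (X z - m)‖ ^ 2) μ ∧
      ∫ z, ‖a + c • (X z - m)‖ ^ 2 ∂μ = ‖a‖ ^ 2 + c ^ 2 * ∫ z, ‖X z - m‖ ^ 2 ∂μ := by
  have hXi : Integrable (fun z => X z - m) μ :=
    (integrable_of_integrable_norm_sub_sq hX hint).sub (integrable_const m)
  have hzero : ∫ z, (X z - m) ∂μ = 0 := by
    rw [integral_sub (integrable_of_integrable_norm_sub_sq hX hint) (integrable_const m), hm]
    simp
  have heq : (fun z => ‖a + c • (X z - m)‖ ^ 2) =
      fun z => ‖a‖ ^ 2 + ((2 * c) * inner ℝ a (X z - m) + c ^ 2 * ‖X z - m‖ ^ 2) := by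
    funext z
    rw [norm_add_sq_real, real_inner_smul_right, norm_smul, mul_pow, Real.norm_eq_abs, sq_abs]
    ring
  have hin : Integrable (fun z => (2 * c) * inner ℝ a (X z - m)) μ :=
    (hXi.const_inner a).const_mul _
  have hsum : Integrable (fun z => (2 * c) * inner ℝ a (X z - m) + c ^ 2 * ‖X z - m‖ ^ 2) μ :=
    hin.add (hint.const_mul _)
  rw [heq]
  refine ⟨(integrable_const _).add hsum, ?_⟩
  rw [integral_add (integrable_const _) hsum, integral_add hin (hint.const_mul _),
    integral_const_mul, integral_const_mul,
    integral_inner hXi, hzero]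
  simp

end Moments

/-! ### One iteration with a fixed sampled task: contraction, moments and bias. -/

section SingleTask

variable {d n : ℕ} {Z : Type*} [MeasurableSpace Z] {α β L ρ G σG σH : ℝ}
  {ℓ : Fin n → Vec d → Z → ℝ} {D : Fin n → Measure Z}

/-- The personalized model of task `i` after an iteration in which task `i` is sampled, with the
data point `z`. -/
def sampledModel (α β : ℝ) (ℓ : Fin n → Vec d → Z → ℝ) (s : State d n) (i : Fin n) (z : Z) :
    Vec d :=
  if i ∈ s.seen then (1 - β) • s.u i + β • (s.w - α • ∇ (fun w' => ℓ i w' z) s.w)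
  else s.w - α • ∇ (fun w' => ℓ i w' z) s.w

/-- The stochastic meta-gradient of an iteration in which task `i` is sampled, with the data points
`z`. -/
def sampledGrad (α β : ℝ) (ℓ : Fin n → Vec d → Z → ℝ) (s : State d n) (i : Fin n)
    (z : Z × Z × Z) : Vec d :=
  (ContinuousLinearMap.id ℝ (Vec d) - α • hess (fun w' => ℓ i w' z.2.1) s.w)
    (∇ (fun w' => ℓ i w' z.2.2) (sampledModel α β ℓ s i z.1))

/-- The squared distance of the personalized model of task `i` to the adapted model; a constant
while the task has not been sampled. -/
def taskError (α σG : ℝ) (ℓ : Fin n → Vec d → Z → ℝ) (D : Fin n → Measure Z) (s : State d n)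
    (i : Fin n) : ℝ :=
  -- The factor 2 lets initialization obey the same contraction bound as a momentum step, because
  -- `2(1 - β) + β² = 1 + (1 - β)² ≥ 1`.
  if i ∈ s.seen then ‖s.u i - adapted α (risk ℓ D i) s.w‖ ^ 2 else 2 * (α ^ 2 * σG ^ 2)

theorem taskError_nonneg (s : State d n) (i : Fin n) : 0 ≤ taskError α σG ℓ D s i := by
  unfold taskError
  split_ifs <;> positivity

theorem Assumptions.measurable_grad (h : Assumptions α L ρ G σG σH ℓ D) (i : Fin n) (w : Vec d) :
    Measurable fun z => ∇ (fun w' => ℓ i w' z) w :=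
  (h.grad_measurable i).comp measurable_prodMk_left

theorem Assumptions.measurable_hess (h : Assumptions α L ρ G σG σH ℓ D) (i : Fin n) (w : Vec d) :
    Measurable fun z => hess (fun w' => ℓ i w' z) w :=
  (h.hess_measurable i).comp measurable_prodMk_left

theorem Assumptions.measurable_sampledModel (h : Assumptions α L ρ G σG σH ℓ D) (s : State d n)
    (i : Fin n) : Measurable (sampledModel α β ℓ s i) := by
  have hg := h.measurable_grad i s.w
  unfold sampledModel
  split_ifs <;> fun_prop

theorem Assumptions.measurable_sampledGrad (h : Assumptions α L ρ G σG σH ℓ D) (s : State d n)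
    (i : Fin n) : Measurable (sampledGrad α β ℓ s i) := by
  have h1 : Measurable fun z : Z × Z × Z =>
      ContinuousLinearMap.id ℝ (Vec d) - α • hess (fun w' => ℓ i w' z.2.1) s.w :=
    (((h.measurable_hess i s.w).comp (measurable_fst.comp measurable_snd)).const_smul α).const_sub _
  have h2 : Measurable fun z : Z × Z × Z =>
      ∇ (fun w' => ℓ i w' z.2.2) (sampledModel α β ℓ s i z.1) :=
    (h.grad_measurable i).comp (((h.measurable_sampledModel s i).comp measurable_fst).prodMk
      (measurable_snd.comp measurable_snd))
  exact ContinuousLinearMap.measurable_apply₂.comp (h1.prodMk h2)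

variable [∀ i, IsProbabilityMeasure (D i)]

theorem Assumptions.integral_sampledModel_sub_sq_le (h : Assumptions α L ρ G σG σH ℓ D)
    (hβ₀ : 0 ≤ β) (hβ₁ : β ≤ 1) (s : State d n) (i : Fin n) :
    Integrable (fun z => ‖sampledModel α β ℓ s i z - adapted α (risk ℓ D i) s.w‖ ^ 2) (D i) ∧
      ∫ z, ‖sampledModel α β ℓ s i z - adapted α (risk ℓ D i) s.w‖ ^ 2 ∂(D i)
        ≤ (1 - β) * taskError α σG ℓ D s i + β ^ 2 * (α ^ 2 * σG ^ 2) := by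
  have hvar := h.grad_variance i s.w
  have key := integral_norm_add_smul_centered_sq (h.measurable_grad i s.w).aestronglyMeasurable
    (h.grad_sq_integrable i s.w) (h.grad_unbiased i s.w)
  have hs : 0 ≤ α ^ 2 * σG ^ 2 := by positivity
  by_cases hi : i ∈ s.seen
  · have heq : ∀ z, sampledModel α β ℓ s i z - adapted α (risk ℓ D i) s.w =
        (1 - β) • (s.u i - adapted α (risk ℓ D i) s.w)
          + (-(β * α)) • (∇ (fun w' => ℓ i w' z) s.w - ∇ (risk ℓ D i) s.w) := fun z => by
      simp only [sampledModel, if_pos hi, adapted]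
      module
    simp only [heq]
    obtain ⟨k1, k2⟩ := key ((1 - β) • (s.u i - adapted α (risk ℓ D i) s.w)) (-(β * α))
    refine ⟨k1, ?_⟩
    rw [k2, norm_smul, mul_pow, Real.norm_eq_abs, sq_abs, taskError, if_pos hi]
    have h1 : (1 - β) ^ 2 ≤ 1 - β := by nlinarith
    have h2 := mul_le_mul_of_nonneg_right h1
      (sq_nonneg ‖s.u i - adapted α (risk ℓ D i) s.w‖)
    have h3 := mul_le_mul_of_nonneg_left hvar (sq_nonneg (-(β * α)))
    nlinarith
  · have heq : ∀ z, sampledModel α β ℓ s i z - adapted α (risk ℓ D i) s.w =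
        0 + (-α) • (∇ (fun w' => ℓ i w' z) s.w - ∇ (risk ℓ D i) s.w) := fun z => by
      simp only [sampledModel, if_neg hi, adapted]
      module
    simp only [heq]
    obtain ⟨k1, k2⟩ := key 0 (-α)
    refine ⟨k1, ?_⟩
    rw [k2, taskError, if_neg hi]
    have h3 := mul_le_mul_of_nonneg_left hvar (sq_nonneg (-α))
    have h4 := mul_nonneg (sq_nonneg (1 - β)) hs
    simp only [norm_zero]
    nlinarith

theorem Assumptions.integral_id_sub_hess_sq_le (h : Assumptions α L ρ G σG σH ℓ D)
    (hα : 0 < α) (hL : 0 ≤ L) (i : Fin n) (w : Vec d) :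
    Integrable (fun z => ContinuousLinearMap.id ℝ (Vec d) - α • hess (fun w' => ℓ i w' z) w) (D i) ∧
    ∫ z, (ContinuousLinearMap.id ℝ (Vec d) - α • hess (fun w' => ℓ i w' z) w) ∂(D i) =
      ContinuousLinearMap.id ℝ (Vec d) - α • hess (risk ℓ D i) w ∧
    Integrable (fun z =>
      ‖ContinuousLinearMap.id ℝ (Vec d) - α • hess (fun w' => ℓ i w' z) w‖ ^ 2) (D i) ∧
    ∫ z, ‖ContinuousLinearMap.id ℝ (Vec d) - α • hess (fun w' => ℓ i w' z) w‖ ^ 2 ∂(D i)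
      ≤ 2 * ((1 + α * L) ^ 2 + α ^ 2 * σH ^ 2) := by
  have hm := (h.measurable_hess i w).aestronglyMeasurable (μ := D i)
  have hi := integrable_of_integrable_norm_sub_sq hm (h.hess_sq_integrable i w)
  have hm' : AEStronglyMeasurable
      (fun z => ContinuousLinearMap.id ℝ (Vec d) - α • hess (fun w' => ℓ i w' z) w) (D i) :=
    aestronglyMeasurable_const.sub (hm.const_smul α)
  have heq : (fun z => ‖(ContinuousLinearMap.id ℝ (Vec d) - α • hess (fun w' => ℓ i w' z) w) -
      (ContinuousLinearMap.id ℝ (Vec d) - α • hess (risk ℓ D i) w)‖ ^ 2) =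
      fun z => α ^ 2 * ‖hess (fun w' => ℓ i w' z) w - hess (risk ℓ D i) w‖ ^ 2 := by
    funext z
    have e : α • hess (risk ℓ D i) w - α • hess (fun w' => ℓ i w' z) w =
        α • (hess (risk ℓ D i) w - hess (fun w' => ℓ i w' z) w) := (smul_sub α _ _).symm
    rw [sub_sub_sub_cancel_left, e, norm_smul, mul_pow, Real.norm_eq_abs, sq_abs, norm_sub_rev]
  have hsq := integral_norm_sq_le_of_integral_norm_sub_sq_le (b := α ^ 2 * σH ^ 2) hm'
    (m := ContinuousLinearMap.id ℝ (Vec d) - α • hess (risk ℓ D i) w)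
    (by rw [heq]; exact (h.hess_sq_integrable i w).const_mul _)
    (norm_id_sub_hess_le hα hL (h.grad_lipschitz i) w)
    (by
      rw [heq, integral_const_mul]
      exact mul_le_mul_of_nonneg_left (h.hess_variance i w) (sq_nonneg α))
  have hi' : Integrable (fun z => α • hess (fun w' => ℓ i w' z) w) (D i) := hi.smul α
  refine ⟨(integrable_const _).sub hi', ?_, hsq⟩
  rw [integral_sub (integrable_const _) hi', integral_smul, h.hess_unbiased i w]
  simp

theorem Assumptions.integral_grad_sq_le (h : Assumptions α L ρ G σG σH ℓ D)
    (i : Fin n) (w : Vec d) :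
    Integrable (fun z => ∇ (fun w' => ℓ i w' z) w) (D i) ∧
    Integrable (fun z => ‖∇ (fun w' => ℓ i w' z) w‖ ^ 2) (D i) ∧
    ∫ z, ‖∇ (fun w' => ℓ i w' z) w‖ ^ 2 ∂(D i) ≤ 2 * (G ^ 2 + σG ^ 2) := by
  have hm := (h.measurable_grad i w).aestronglyMeasurable (μ := D i)
  exact ⟨integrable_of_integrable_norm_sub_sq hm (h.grad_sq_integrable i w),
    integral_norm_sq_le_of_integral_norm_sub_sq_le hm (h.grad_sq_integrable i w)
      (h.grad_bounded i w) (h.grad_variance i w)⟩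

/-- With the first data point frozen, the Hessian and gradient factors are independent, so the
second moment is at most a product of two second moments, both bounded uniformly in the model. -/
theorem Assumptions.integral_sampledGrad_sq_le (h : Assumptions α L ρ G σG σH ℓ D)
    (hα : 0 < α) (hL : 0 ≤ L) (s : State d n) (i : Fin n) :
    Integrable (fun z => ‖sampledGrad α β ℓ s i z‖ ^ 2) ((D i).prod ((D i).prod (D i))) ∧
    ∫ z, ‖sampledGrad α β ℓ s i z‖ ^ 2 ∂((D i).prod ((D i).prod (D i)))
      ≤ 2 * ((1 + α * L) ^ 2 + α ^ 2 * σH ^ 2) * (2 * (G ^ 2 + σG ^ 2)) := by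
  obtain ⟨-, -, hH, hH'⟩ := h.integral_id_sub_hess_sq_le hα hL i s.w
  have hprod : ∀ z₁, Integrable (fun z : Z × Z =>
      ‖ContinuousLinearMap.id ℝ (Vec d) - α • hess (fun w' => ℓ i w' z.1) s.w‖ ^ 2 *
        ‖∇ (fun w' => ℓ i w' z.2) (sampledModel α β ℓ s i z₁)‖ ^ 2) ((D i).prod (D i)) := fun z₁ =>
    hH.mul_prod (h.integral_grad_sq_le i (sampledModel α β ℓ s i z₁)).2.1
  have hle : ∀ z₁, ∀ z : Z × Z, ‖sampledGrad α β ℓ s i (z₁, z)‖ ^ 2 ≤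
      ‖ContinuousLinearMap.id ℝ (Vec d) - α • hess (fun w' => ℓ i w' z.1) s.w‖ ^ 2 *
        ‖∇ (fun w' => ℓ i w' z.2) (sampledModel α β ℓ s i z₁)‖ ^ 2 := fun z₁ z => by
    rw [← mul_pow]
    exact pow_le_pow_left₀ (norm_nonneg _) (ContinuousLinearMap.le_opNorm _ _) 2
  have hint : ∀ z₁, Integrable (fun z : Z × Z => ‖sampledGrad α β ℓ s i (z₁, z)‖ ^ 2)
      ((D i).prod (D i)) := fun z₁ => by
    refine (hprod z₁).mono' ?_ (Filter.Eventually.of_forall fun z => ?_)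
    · exact (((h.measurable_sampledGrad s i).comp measurable_prodMk_left).norm.pow_const
        2).aestronglyMeasurable
    · rw [Real.norm_of_nonneg (by positivity)]
      exact hle z₁ z
  refine integrable_prod_of_forall_integral_le
    ((h.measurable_sampledGrad s i).norm.pow_const 2).aestronglyMeasurable
    (fun _ => by positivity) hint fun z₁ => ?_
  refine (integral_mono (hint z₁) (hprod z₁) (hle z₁)).trans ?_
  rw [integral_prod_mul
    (fun z => ‖ContinuousLinearMap.id ℝ (Vec d) - α • hess (fun w' => ℓ i w' z) s.w‖ ^ 2)
    (fun z => ‖∇ (fun w' => ℓ i w' z) (sampledModel α β ℓ s i z₁)‖ ^ 2)]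
  exact mul_le_mul hH' (h.integral_grad_sq_le i _).2.2 (integral_nonneg fun _ => by positivity)
    (by positivity)

theorem Assumptions.integrable_sampledGrad (h : Assumptions α L ρ G σG σH ℓ D)
    (hα : 0 < α) (hL : 0 ≤ L) (s : State d n) (i : Fin n) :
    Integrable (sampledGrad α β ℓ s i) ((D i).prod ((D i).prod (D i))) :=
  ((memLp_two_iff_integrable_sq_norm (h.measurable_sampledGrad s i).aestronglyMeasurable).mpr
    (h.integral_sampledGrad_sq_le hα hL s i).1).integrable (by norm_num)

theorem Assumptions.integral_inner_sampledGrad (h : Assumptions α L ρ G σG σH ℓ D)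
    (hα : 0 < α) (hL : 0 ≤ L) (s : State d n) (i : Fin n) (a : Vec d) :
    ∫ z, inner ℝ a (sampledGrad α β ℓ s i z) ∂((D i).prod ((D i).prod (D i))) =
      ∫ z, inner ℝ a ((ContinuousLinearMap.id ℝ (Vec d) - α • hess (risk ℓ D i) s.w)
        (∇ (risk ℓ D i) (sampledModel α β ℓ s i z))) ∂(D i) := by
  have hint := h.integrable_sampledGrad (β := β) hα hL s i
  obtain ⟨hH, hH', -⟩ := h.integral_id_sub_hess_sq_le hα hL i s.w
  rw [integral_prod _ (hint.const_inner a)]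
  refine integral_congr_ae (Filter.Eventually.of_forall fun z₁ => ?_)
  have hg := (h.integral_grad_sq_le i (sampledModel α β ℓ s i z₁)).1
  have hop : Integrable (fun z : Z × Z => sampledGrad α β ℓ s i (z₁, z)) ((D i).prod (D i)) :=
    hH.op_fst_snd (op := fun A x => A x) (by fun_prop)
      ⟨1, fun A x => by simpa using A.le_opNorm x⟩ hg
  -- The mean of an independent operator applied to an independent vector is the mean operator
  -- applied to the mean vector.
  have hbil := integral_prod_bilin (ContinuousLinearMap.id ℝ (Vec d →L[ℝ] Vec d)) hH hg
  rw [hH', h.grad_unbiased i] at hbil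
  change ∫ z : Z × Z, inner ℝ a (sampledGrad α β ℓ s i (z₁, z)) ∂((D i).prod (D i)) = _
  rw [integral_inner hop]
  exact congrArg (inner ℝ a) hbil

/-- After averaging over the last two data points, only the displacement of the model from `vᵢ(w)`
biases the meta-gradient. Young's inequality spends half of `‖a‖²`; for `a = ∇F(w)` the other half
survives. -/
theorem Assumptions.le_integral_inner_sampledGrad (h : Assumptions α L ρ G σG σH ℓ D)
    (hα : 0 < α) (hL : 0 ≤ L) (hβ₀ : 0 ≤ β) (hβ₁ : β ≤ 1) (s : State d n) (i : Fin n)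
    (a : Vec d) :
    inner ℝ a (adaptedGrad α (risk ℓ D i) s.w) - ‖a‖ ^ 2 / 2 - ((1 + α * L) * L) ^ 2 / 2 *
        ∫ z, ‖sampledModel α β ℓ s i z - adapted α (risk ℓ D i) s.w‖ ^ 2 ∂(D i)
      ≤ ∫ z, inner ℝ a (sampledGrad α β ℓ s i z) ∂((D i).prod ((D i).prod (D i))) := by
  have hQ := (h.integral_sampledModel_sub_sq_le hβ₀ hβ₁ s i).1
  have hk : 0 ≤ 1 + α * L := by positivity
  rw [h.integral_inner_sampledGrad hα hL]
  have hlhs : Integrable (fun z => (inner ℝ a (adaptedGrad α (risk ℓ D i) s.w) - ‖a‖ ^ 2 / 2) -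
      ((1 + α * L) * L) ^ 2 / 2 *
        ‖sampledModel α β ℓ s i z - adapted α (risk ℓ D i) s.w‖ ^ 2) (D i) :=
    (integrable_const _).sub (hQ.const_mul _)
  have hrhs : Integrable (fun z => inner ℝ a
      ((ContinuousLinearMap.id ℝ (Vec d) - α • hess (risk ℓ D i) s.w)
        (∇ (risk ℓ D i) (sampledModel α β ℓ s i z)))) (D i) := by
    refine Integrable.of_bound ?_ (‖a‖ * ((1 + α * L) * G)) (Filter.Eventually.of_forall fun z => ?_)
    · exact (measurable_const.inner ((ContinuousLinearMap.measurable _).comp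
        ((contDiff_gradient (h.risk_contDiff i)).continuous.measurable.comp
          (h.measurable_sampledModel s i)))).aestronglyMeasurable
    · refine (norm_inner_le_norm _ _).trans (mul_le_mul_of_nonneg_left ?_ (norm_nonneg _))
      exact (ContinuousLinearMap.le_of_opNorm_le _
        (norm_id_sub_hess_le hα hL (h.grad_lipschitz i) _) _).trans
        (mul_le_mul_of_nonneg_left (h.grad_bounded i _) hk)
  have hle := integral_mono hlhs hrhs fun z => by
    have h1 : ‖(ContinuousLinearMap.id ℝ (Vec d) - α • hess (risk ℓ D i) s.w)
        (∇ (risk ℓ D i) (sampledModel α β ℓ s i z)) - adaptedGrad α (risk ℓ D i) s.w‖ ≤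
        (1 + α * L) * L * ‖sampledModel α β ℓ s i z - adapted α (risk ℓ D i) s.w‖ := by
      rw [adaptedGrad, ← map_sub, mul_assoc]
      exact (ContinuousLinearMap.le_of_opNorm_le _
        (norm_id_sub_hess_le hα hL (h.grad_lipschitz i) _) _).trans
        (mul_le_mul_of_nonneg_left (h.grad_lipschitz i _ _) hk)
    have h2 := neg_le_of_abs_le (abs_real_inner_le_norm a
      ((ContinuousLinearMap.id ℝ (Vec d) - α • hess (risk ℓ D i) s.w)
        (∇ (risk ℓ D i) (sampledModel α β ℓ s i z)) - adaptedGrad α (risk ℓ D i) s.w))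
    rw [inner_sub_right] at h2
    have h3 := pow_le_pow_left₀ (norm_nonneg _) h1 2
    rw [mul_pow] at h3
    have h4 := two_mul_le_add_sq ‖a‖
      ‖(ContinuousLinearMap.id ℝ (Vec d) - α • hess (risk ℓ D i) s.w)
        (∇ (risk ℓ D i) (sampledModel α β ℓ s i z)) - adaptedGrad α (risk ℓ D i) s.w‖
    linarith
  rw [integral_sub (integrable_const _) (hQ.const_mul _), integral_const_mul] at hle
  simpa using hle

end SingleTask

/-! ### Drift of the Lyapunov function. -/

section Potential

variable {d n : ℕ} {Z : Type*} [MeasurableSpace Z] {α β η L ρ G σG σH A c : ℝ}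
  {ℓ : Fin n → Vec d → Z → ℝ} {D : Fin n → Measure Z}

/-- The state after an iteration in which task `i` is sampled, with the data points `z`. -/
def sampledState (α η β : ℝ) (ℓ : Fin n → Vec d → Z → ℝ) (s : State d n) (i : Fin n)
    (z : Z × Z × Z) : State d n where
  w := s.w - η • sampledGrad α β ℓ s i z
  u := Function.update s.u i (sampledModel α β ℓ s i z.1)
  seen := s.seen ∪ {i}

/-- The Lyapunov function: the optimality gap plus a multiple of the errors of the tasks. -/
def potential (A α σG : ℝ) (ℓ : Fin n → Vec d → Z → ℝ) (D : Fin n → Measure Z) (s : State d n) :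
    ℝ :=
  metaObjective α ℓ D s.w - (⨅ w, metaObjective α ℓ D w) + A * ∑ i, taskError α σG ℓ D s i

theorem Assumptions.potential_nonneg (h : Assumptions α L ρ G σG σH ℓ D) (hA : 0 ≤ A)
    (s : State d n) : 0 ≤ potential A α σG ℓ D s :=
  add_nonneg (sub_nonneg.mpr (ciInf_le h.bddBelow s.w))
    (mul_nonneg hA (Finset.sum_nonneg fun i _ => taskError_nonneg s i))

theorem norm_sub_sq_le_add {E : Type*} [SeminormedAddCommGroup E] (hc : 0 < c) (x y z : E) :
    ‖x - z‖ ^ 2 ≤ (1 + c) * ‖x - y‖ ^ 2 + (1 + c⁻¹) * ‖z - y‖ ^ 2 := by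
  have h1 : ‖x - z‖ ≤ ‖x - y‖ + ‖z - y‖ := by
    simpa using norm_sub_le (x - y) (z - y)
  have h2 : 2 * ‖x - y‖ * ‖z - y‖ ≤ c * ‖x - y‖ ^ 2 + c⁻¹ * ‖z - y‖ ^ 2 := by
    have e : c * ‖x - y‖ ^ 2 + c⁻¹ * ‖z - y‖ ^ 2 - 2 * ‖x - y‖ * ‖z - y‖ =
        c⁻¹ * (c * ‖x - y‖ - ‖z - y‖) ^ 2 := by
      field_simp
      ring
    have : 0 ≤ c⁻¹ * (c * ‖x - y‖ - ‖z - y‖) ^ 2 := by positivity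
    linarith
  have h3 := pow_le_pow_left₀ (norm_nonneg _) h1 2
  nlinarith

/-- All adapted models move with `w`, including those of the tasks not sampled; Young's inequality
separates this motion from the previous error. -/
theorem Assumptions.taskError_sampledState_le (h : Assumptions α L ρ G σG σH ℓ D)
    (hα : 0 < α) (hc : 0 < c) (s : State d n) (i j : Fin n) (z : Z × Z × Z) :
    taskError α σG ℓ D (sampledState α η β ℓ s i z) j ≤
      (1 + c) * Function.update (taskError α σG ℓ D s) i
          (‖sampledModel α β ℓ s i z.1 - adapted α (risk ℓ D i) s.w‖ ^ 2) j
        + (1 + c⁻¹) * ((1 + α * L) ^ 2 * η ^ 2 * ‖sampledGrad α β ℓ s i z‖ ^ 2) := by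
  have hc' : 0 < c⁻¹ := inv_pos.mpr hc
  have hmove : ∀ k, ‖adapted α (risk ℓ D k) (sampledState α η β ℓ s i z).w
      - adapted α (risk ℓ D k) s.w‖ ^ 2
      ≤ (1 + α * L) ^ 2 * η ^ 2 * ‖sampledGrad α β ℓ s i z‖ ^ 2 := fun k => by
    refine (pow_le_pow_left₀ (norm_nonneg _)
      (norm_adapted_sub_le hα (h.grad_lipschitz k) _ _) 2).trans_eq ?_
    simp only [sampledState, sub_sub_cancel_left, norm_neg, norm_smul, mul_pow, Real.norm_eq_abs,
      sq_abs]
    ring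
  have hyoung : ∀ k (x : Vec d), ‖x - adapted α (risk ℓ D k) (sampledState α η β ℓ s i z).w‖ ^ 2
      ≤ (1 + c) * ‖x - adapted α (risk ℓ D k) s.w‖ ^ 2
        + (1 + c⁻¹) * ((1 + α * L) ^ 2 * η ^ 2 * ‖sampledGrad α β ℓ s i z‖ ^ 2) := fun k x =>
    (norm_sub_sq_le_add hc x (adapted α (risk ℓ D k) s.w) _).trans
      (add_le_add_right (mul_le_mul_of_nonneg_left (hmove k) (by positivity)) _)
  by_cases hj : j = i
  · subst hj
    have hseen : j ∈ (sampledState α η β ℓ s j z).seen := by simp [sampledState]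
    rw [taskError, if_pos hseen, Function.update_self]
    have hu : (sampledState α η β ℓ s j z).u j = sampledModel α β ℓ s j z.1 := by
      simp [sampledState]
    rw [hu]
    exact hyoung j _
  · rw [Function.update_of_ne hj]
    have hu : (sampledState α η β ℓ s i z).u j = s.u j := by
      simp [sampledState, hj]
    have hseen : j ∈ (sampledState α η β ℓ s i z).seen ↔ j ∈ s.seen := by
      simp [sampledState, hj]
    unfold taskError
    simp only [hseen, hu]
    split_ifs
    · exact hyoung j _
    -- A task still unseen keeps its constant error, so the factor `1 + c` suffices.
    · have h1 : 0 ≤ c * (2 * (α ^ 2 * σG ^ 2)) := by positivity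
      have h2 : 0 ≤ (1 + c⁻¹) * ((1 + α * L) ^ 2 * η ^ 2 * ‖sampledGrad α β ℓ s i z‖ ^ 2) := by
        positivity
      linarith

theorem Assumptions.sum_taskError_sampledState_le (h : Assumptions α L ρ G σG σH ℓ D)
    (hα : 0 < α) (hc : 0 < c) (s : State d n) (i : Fin n) (z : Z × Z × Z) :
    ∑ j, taskError α σG ℓ D (sampledState α η β ℓ s i z) j ≤
      (1 + c) * (∑ j, taskError α σG ℓ D s j - taskError α σG ℓ D s i
          + ‖sampledModel α β ℓ s i z.1 - adapted α (risk ℓ D i) s.w‖ ^ 2)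
        + n * (1 + c⁻¹) * ((1 + α * L) ^ 2 * η ^ 2) * ‖sampledGrad α β ℓ s i z‖ ^ 2 := by
  refine (Finset.sum_le_sum fun j _ =>
    h.taskError_sampledState_le (η := η) (β := β) hα hc s i j z).trans_eq ?_
  have hsum : ∑ j, taskError α σG ℓ D s j - taskError α σG ℓ D s i =
      ∑ j ∈ Finset.univ \ {i}, taskError α σG ℓ D s j := by
    rw [← Finset.sum_sdiff (Finset.subset_univ {i}), Finset.sum_singleton, add_sub_cancel_right]
  rw [Finset.sum_add_distrib, ← Finset.mul_sum, Finset.sum_update_of_mem (Finset.mem_univ i), hsum]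
  simp only [Finset.sum_const, Finset.card_univ, Fintype.card_fin, nsmul_eq_mul]
  ring

theorem Assumptions.potential_sampledState_le (h : Assumptions α L ρ G σG σH ℓ D)
    (hn : 0 < n) (hα : 0 < α) (hL : 0 ≤ L) (hρ : 0 ≤ ρ) (hG : 0 < G) (hA : 0 ≤ A) (hc : 0 < c)
    (s : State d n) (i : Fin n) (z : Z × Z × Z) :
    potential A α σG ℓ D (sampledState α η β ℓ s i z) ≤
      (metaObjective α ℓ D s.w - (⨅ w, metaObjective α ℓ D w)
        + A * (1 + c) * (∑ j, taskError α σG ℓ D s j - taskError α σG ℓ D s i))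
      + (-η * inner ℝ (metaObjectiveGrad α ℓ D s.w) (sampledGrad α β ℓ s i z)
      + ((((1 + α * L) ^ 2 * L + α * ρ * G) * η ^ 2
          + A * (n * (1 + c⁻¹) * ((1 + α * L) ^ 2 * η ^ 2))) * ‖sampledGrad α β ℓ s i z‖ ^ 2
      + A * (1 + c) * ‖sampledModel α β ℓ s i z.1 - adapted α (risk ℓ D i) s.w‖ ^ 2)) := by
  have h1 := h.metaObjective_descent hn hα hL hρ hG s.w (sampledState α η β ℓ s i z).w
  have hw : (sampledState α η β ℓ s i z).w - s.w = -(η • sampledGrad α β ℓ s i z) := by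
    simp [sampledState]
  rw [hw, inner_neg_right, real_inner_smul_right, norm_neg, norm_smul, mul_pow, Real.norm_eq_abs,
    sq_abs] at h1
  have h2 := mul_le_mul_of_nonneg_left
    (h.sum_taskError_sampledState_le (η := η) (β := β) hα hc s i z) hA
  rw [potential]
  linarith

variable [∀ i, IsProbabilityMeasure (D i)]

/-- The witness `b` is the Bochner integral of an integrable pointwise majorant of the potential.
Stating the result with `∫⁻` avoids tracking integrability of the potential along the iterates. -/
theorem Assumptions.lintegral_potential_sampledState_le (h : Assumptions α L ρ G σG σH ℓ D)
    (hn : 0 < n) (hα : 0 < α) (hL : 0 ≤ L) (hρ : 0 ≤ ρ) (hG : 0 < G) (hβ₀ : 0 ≤ β) (hβ₁ : β ≤ 1)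
    (hη : 0 ≤ η) (hA : 0 ≤ A) (hc : 0 < c) (s : State d n) (i : Fin n) :
    ∃ b : ℝ, 0 ≤ b ∧
      b ≤ metaObjective α ℓ D s.w - (⨅ w, metaObjective α ℓ D w)
        + A * (1 + c) * (∑ j, taskError α σG ℓ D s j - taskError α σG ℓ D s i)
        - η * inner ℝ (metaObjectiveGrad α ℓ D s.w) (adaptedGrad α (risk ℓ D i) s.w)
        + η * ‖metaObjectiveGrad α ℓ D s.w‖ ^ 2 / 2
        + (η * ((1 + α * L) * L) ^ 2 / 2 + A * (1 + c))
          * ((1 - β) * taskError α σG ℓ D s i + β ^ 2 * (α ^ 2 * σG ^ 2))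
        + (((1 + α * L) ^ 2 * L + α * ρ * G) * η ^ 2
          + A * (n * (1 + c⁻¹) * ((1 + α * L) ^ 2 * η ^ 2)))
          * (2 * ((1 + α * L) ^ 2 + α ^ 2 * σH ^ 2) * (2 * (G ^ 2 + σG ^ 2))) ∧
      ∫⁻ z, ENNReal.ofReal (potential A α σG ℓ D (sampledState α η β ℓ s i z))
        ∂((D i).prod ((D i).prod (D i))) ≤ ENNReal.ofReal b := by
  have hc' : 0 < c⁻¹ := inv_pos.mpr hc
  obtain ⟨hM, hM'⟩ := h.integral_sampledGrad_sq_le (β := β) hα hL s i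
  obtain ⟨hQ, hQ'⟩ := h.integral_sampledModel_sub_sq_le hβ₀ hβ₁ s i
  have hI := h.le_integral_inner_sampledGrad hα hL hβ₀ hβ₁ s i (metaObjectiveGrad α ℓ D s.w)
  have hIi := (h.integrable_sampledGrad (β := β) hα hL s i).const_inner
    (𝕜 := ℝ) (metaObjectiveGrad α ℓ D s.w)
  have hQp : Integrable (fun z : Z × Z × Z =>
      ‖sampledModel α β ℓ s i z.1 - adapted α (risk ℓ D i) s.w‖ ^ 2)
      ((D i).prod ((D i).prod (D i))) := hQ.comp_fst ((D i).prod (D i))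
  have hQint : ∫ z : Z × Z × Z, ‖sampledModel α β ℓ s i z.1 - adapted α (risk ℓ D i) s.w‖ ^ 2
      ∂((D i).prod ((D i).prod (D i))) =
      ∫ z, ‖sampledModel α β ℓ s i z - adapted α (risk ℓ D i) s.w‖ ^ 2 ∂(D i) := by
    rw [integral_fun_fst (fun z => ‖sampledModel α β ℓ s i z - adapted α (risk ℓ D i) s.w‖ ^ 2)]
    simp
  set κ := ((1 + α * L) ^ 2 * L + α * ρ * G) * η ^ 2
          + A * (n * (1 + c⁻¹) * ((1 + α * L) ^ 2 * η ^ 2)) with hκ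
  have hκ₀ : 0 ≤ κ := by positivity
  set c₀ := metaObjective α ℓ D s.w - (⨅ w, metaObjective α ℓ D w)
        + A * (1 + c) * (∑ j, taskError α σG ℓ D s j - taskError α σG ℓ D s i) with hc₀
  have hle := fun z => h.potential_sampledState_le (η := η) (β := β) hn hα hL hρ hG hA hc s i z
  simp only [← hκ, ← hc₀] at hle
  have hi2 : Integrable (fun z => κ * ‖sampledGrad α β ℓ s i z‖ ^ 2
      + A * (1 + c) * ‖sampledModel α β ℓ s i z.1 - adapted α (risk ℓ D i) s.w‖ ^ 2)
      ((D i).prod ((D i).prod (D i))) := (hM.const_mul _).add (hQp.const_mul _)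
  have hi1 : Integrable (fun z =>
      -η * inner ℝ (metaObjectiveGrad α ℓ D s.w) (sampledGrad α β ℓ s i z)
      + (κ * ‖sampledGrad α β ℓ s i z‖ ^ 2
      + A * (1 + c) * ‖sampledModel α β ℓ s i z.1 - adapted α (risk ℓ D i) s.w‖ ^ 2))
      ((D i).prod ((D i).prod (D i))) := (hIi.const_mul _).add hi2
  have hi0 : Integrable (fun z => c₀ +
      (-η * inner ℝ (metaObjectiveGrad α ℓ D s.w) (sampledGrad α β ℓ s i z)
      + (κ * ‖sampledGrad α β ℓ s i z‖ ^ 2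
      + A * (1 + c) * ‖sampledModel α β ℓ s i z.1 - adapted α (risk ℓ D i) s.w‖ ^ 2)))
      ((D i).prod ((D i).prod (D i))) := (integrable_const c₀).add hi1
  have hnonneg := fun z => (h.potential_nonneg hA _).trans (hle z)
  refine ⟨_, integral_nonneg hnonneg, ?_,
    (lintegral_mono fun z => ENNReal.ofReal_le_ofReal (hle z)).trans_eq
      (ofReal_integral_eq_lintegral_ofReal hi0 (Filter.Eventually.of_forall hnonneg)).symm⟩
  rw [integral_add (integrable_const c₀) hi1, integral_add (hIi.const_mul _) hi2,
    integral_add (hM.const_mul _) (hQp.const_mul _), integral_const_mul, integral_const_mul,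
    integral_const_mul, hQint]
  simp only [integral_const, probReal_univ, one_smul]
  have h1 := mul_le_mul_of_nonneg_left hI hη
  have h2 := mul_le_mul_of_nonneg_left hM' hκ₀
  have h3 := mul_le_mul_of_nonneg_left hQ'
    (show 0 ≤ η * ((1 + α * L) * L) ^ 2 / 2 + A * (1 + c) by positivity)
  linarith

/-- Averaging over the task turns the inner products into `‖∇F‖²` and the contraction of one error
into `1 - β/n` for their sum. The condition `hAc` says that this contraction pays for both the bias
and the Young factor `1 + c`. -/
theorem Assumptions.average_lintegral_potential_add_le (h : Assumptions α L ρ G σG σH ℓ D)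
    (hn : 0 < n) (hα : 0 < α) (hL : 0 ≤ L) (hρ : 0 ≤ ρ) (hG : 0 < G) (hβ₀ : 0 ≤ β) (hβ₁ : β ≤ 1)
    (hη : 0 ≤ η) (hA : 0 ≤ A) (hc : 0 < c)
    (hAc : A * (1 + c) * (1 - β / n) + η * ((1 + α * L) * L) ^ 2 / 2 / n ≤ A) (s : State d n) :
    (n : ENNReal)⁻¹ * ∑ i, ∫⁻ z, ENNReal.ofReal
        (potential A α σG ℓ D (sampledState α η β ℓ s i z)) ∂((D i).prod ((D i).prod (D i)))
        + ENNReal.ofReal (η / 2 * ‖metaObjectiveGrad α ℓ D s.w‖ ^ 2) ≤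
      ENNReal.ofReal (potential A α σG ℓ D s)
        + ENNReal.ofReal ((η * ((1 + α * L) * L) ^ 2 / 2 + A * (1 + c))
            * (β ^ 2 * (α ^ 2 * σG ^ 2))
          + (((1 + α * L) ^ 2 * L + α * ρ * G) * η ^ 2
            + A * (n * (1 + c⁻¹) * ((1 + α * L) ^ 2 * η ^ 2)))
            * (2 * ((1 + α * L) ^ 2 + α ^ 2 * σH ^ 2) * (2 * (G ^ 2 + σG ^ 2)))) := by
  have hn' : (0 : ℝ) < n := Nat.cast_pos.mpr hn
  choose b hb₀ hb hlint using fun i => h.lintegral_potential_sampledState_le (η := η) (β := β)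
    hn hα hL hρ hG hβ₀ hβ₁ hη hA hc s i
  have hreal : (n : ℝ)⁻¹ * ∑ i, b i + η / 2 * ‖metaObjectiveGrad α ℓ D s.w‖ ^ 2 ≤
      potential A α σG ℓ D s + ((η * ((1 + α * L) * L) ^ 2 / 2 + A * (1 + c))
            * (β ^ 2 * (α ^ 2 * σG ^ 2))
          + (((1 + α * L) ^ 2 * L + α * ρ * G) * η ^ 2
            + A * (n * (1 + c⁻¹) * ((1 + α * L) ^ 2 * η ^ 2)))
            * (2 * ((1 + α * L) ^ 2 + α ^ 2 * σH ^ 2) * (2 * (G ^ 2 + σG ^ 2)))) := by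
    have hk : 0 ≤ η * ((1 + α * L) * L) ^ 2 / 2 := by positivity
    generalize 2 * ((1 + α * L) ^ 2 + α ^ 2 * σH ^ 2) * (2 * (G ^ 2 + σG ^ 2)) = M at hb ⊢
    generalize η * ((1 + α * L) * L) ^ 2 / 2 = k at hb hAc hk ⊢
    generalize ((1 + α * L) ^ 2 * L + α * ρ * G) * η ^ 2
            + A * (n * (1 + c⁻¹) * ((1 + α * L) ^ 2 * η ^ 2)) = κ at hb ⊢
    generalize α ^ 2 * σG ^ 2 = v at hb ⊢
    have hE : 0 ≤ ∑ i, taskError α σG ℓ D s i := Finset.sum_nonneg fun i _ => taskError_nonneg s i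
    have hsum := Finset.sum_le_sum fun i (_ : i ∈ Finset.univ) => hb i
    have hinner : ∑ i, inner ℝ (metaObjectiveGrad α ℓ D s.w) (adaptedGrad α (risk ℓ D i) s.w) =
        n * ‖metaObjectiveGrad α ℓ D s.w‖ ^ 2 := by
      have hs : ∑ i, adaptedGrad α (risk ℓ D i) s.w = (n : ℝ) • metaObjectiveGrad α ℓ D s.w := by
        rw [metaObjectiveGrad, smul_inv_smul₀ hn'.ne']
      rw [← inner_sum, hs, real_inner_smul_right, real_inner_self_eq_norm_sq]
    simp only [Finset.sum_add_distrib, Finset.sum_sub_distrib, ← Finset.mul_sum, hinner,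
      Finset.sum_const, Finset.card_univ, Fintype.card_fin, nsmul_eq_mul] at hsum
    have hkey := mul_le_mul_of_nonneg_right hAc hE
    have hpos : 0 ≤ k * β * (∑ i, taskError α σG ℓ D s i) / n := by
      positivity
    refine (add_le_add_left (mul_le_mul_of_nonneg_left hsum (inv_nonneg.mpr hn'.le)) _).trans ?_
    rw [potential]
    generalize (⨅ w, metaObjective α ℓ D w) = m at *
    generalize metaObjective α ℓ D s.w = F at *
    generalize ∑ i, taskError α σG ℓ D s i = E at *
    generalize ‖metaObjectiveGrad α ℓ D s.w‖ ^ 2 = g at *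
    refine le_of_sub_nonneg ?_
    -- The slack consists of the margin in `hAc` and of `kβE/n`, since `hAc` charges the bias to the
    -- error before its contraction by `1 - β`.
    have e : F - m + A * E + ((k + A * (1 + c)) * (β ^ 2 * v) + κ * M) -
        ((n : ℝ)⁻¹ * (n * F - n * m + A * (1 + c) * (n * E - E) - η * (n * g) + n * (η * g / 2)
          + (k + A * (1 + c)) * ((1 - β) * E + β ^ 2 * (n * v)) + κ * (n * M)) + η / 2 * g) =
        A * E - (A * (1 + c) * (1 - β / n) + k / n) * E + k * β * E / n := by
      field_simp
      ring
    rw [e]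
    linarith
  calc _ ≤ (n : ENNReal)⁻¹ * ∑ i, ENNReal.ofReal (b i)
        + ENNReal.ofReal (η / 2 * ‖metaObjectiveGrad α ℓ D s.w‖ ^ 2) := by
        gcongr with i
        exact hlint i
    _ = ENNReal.ofReal ((n : ℝ)⁻¹ * ∑ i, b i + η / 2 * ‖metaObjectiveGrad α ℓ D s.w‖ ^ 2) := by
        rw [ENNReal.ofReal_add (mul_nonneg (inv_nonneg.mpr hn'.le)
            (Finset.sum_nonneg fun i _ => hb₀ i)) (by positivity),
          ENNReal.ofReal_mul (inv_nonneg.mpr hn'.le), ENNReal.ofReal_inv_of_pos hn',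
          ENNReal.ofReal_natCast, ENNReal.ofReal_sum_of_nonneg fun i _ => hb₀ i]
    _ ≤ _ := (ENNReal.ofReal_le_ofReal hreal).trans ENNReal.ofReal_add_le

end Potential

/-! ### Uniform sampling of a single task. -/

section UniformSampling

theorem lintegral_uniformOn_univ {ι : Type*} [MeasurableSpace ι] [MeasurableSingletonClass ι]
    [Fintype ι] (f : ι → ENNReal) :
    ∫⁻ i, f i ∂(uniformOn (Set.univ : Set ι)) = (Fintype.card ι : ENNReal)⁻¹ * ∑ i, f i := by
  rw [uniformOn, ProbabilityTheory.cond, Measure.restrict_univ, lintegral_smul_measure,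
    lintegral_fintype, Measure.count_univ, ENat.card_eq_coe_fintype_card]
  simp

instance instFintypeTaskBatch (n B : ℕ) : Fintype (TaskBatch n B) :=
  inferInstanceAs (Fintype {s : Finset (Fin n) // s.card = B})

instance instDiscreteMeasurableSpaceTaskBatch (n B : ℕ) :
    DiscreteMeasurableSpace (TaskBatch n B) :=
  ⟨fun _ => trivial⟩

/-- A single task, as a batch. -/
def singletonBatch {n : ℕ} (i : Fin n) : TaskBatch n 1 := ⟨{i}, Finset.card_singleton i⟩

theorem bijective_singletonBatch {n : ℕ} :
    Function.Bijective (singletonBatch : Fin n → TaskBatch n 1) := by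
  refine ⟨fun i j hij => Finset.singleton_injective (congrArg Subtype.val hij), fun b => ?_⟩
  obtain ⟨i, hi⟩ := Finset.card_eq_one.mp b.2
  exact ⟨i, Subtype.ext hi.symm⟩

theorem lintegral_uniformOn_taskBatch {n : ℕ} (f : TaskBatch n 1 → ENNReal) :
    ∫⁻ b, f b ∂(uniformOn (Set.univ : Set (TaskBatch n 1))) =
      (n : ENNReal)⁻¹ * ∑ i, f (singletonBatch i) := by
  rw [lintegral_uniformOn_univ, ← Fintype.card_of_bijective (bijective_singletonBatch (n := n)),
    Fintype.card_fin, (bijective_singletonBatch (n := n)).sum_comp f]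

end UniformSampling

/-! ### Pathwise form of an iteration and dependence on the past. -/

section Deterministic

variable {d n B K : ℕ} {Z : Type*} {α β η : ℝ} {ℓ : Fin n → Vec d → Z → ℝ}

theorem step_singletonBatch (s : State d n) (i : Fin n) (S : DataBatch n 1 Z × DataBatch n 1 Z ×
    DataBatch n 1 Z) :
    step α η β ℓ s (singletonBatch i, S) =
      sampledState α η β ℓ s i (S.1 i 0, S.2.1 i 0, S.2.2 i 0) := by
  have hu : updateU α β ℓ s (singletonBatch i) S.1 =
      Function.update s.u i (sampledModel α β ℓ s i (S.1 i 0)) := by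
    funext j
    by_cases hj : j = i
    · subst hj
      simp [updateU, singletonBatch, sampledModel, batchGrad]
    · simp [updateU, singletonBatch, hj]
  simp only [step, sampledState, hu, State.mk.injEq, true_and]
  simp [metaGrad, singletonBatch, sampledGrad, batchGrad, batchHess]

theorem run_congr {w₀ : Vec d} {x y : ℕ → StepSample n B K Z} {t : ℕ} (hxy : ∀ j < t, x j = y j) :
    run α η β ℓ w₀ x t = run α η β ℓ w₀ y t := by
  induction t with
  | zero => rfl
  | succ t ih => rw [run, run, ih fun j hj => hxy j (hj.trans t.lt_succ_self), hxy t t.lt_succ_self]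

end Deterministic

/-! ### Law of one iteration. -/

section OneStep

variable {d n : ℕ} {Z : Type*} [MeasurableSpace Z] {α β η L ρ G σG σH A c : ℝ}
  {ℓ : Fin n → Vec d → Z → ℝ} {D : Fin n → Measure Z}

instance instIsProbabilityMeasureDataLaw (K : ℕ) [∀ i, IsProbabilityMeasure (D i)] :
    IsProbabilityMeasure (dataLaw K D) := by
  unfold dataLaw
  infer_instance

theorem measurePreserving_dataLaw [∀ i, IsProbabilityMeasure (D i)] (i : Fin n) :
    MeasurePreserving (fun S : DataBatch n 1 Z => S i 0) (dataLaw 1 D) (D i) :=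
  (measurePreserving_eval (fun _ : Fin 1 => D i) 0).comp
    (measurePreserving_eval (fun i => Measure.pi fun _ : Fin 1 => D i) i)

/-- An iteration with `B = K = 1` reads only three data points of the sampled task, so the product
law over all tasks is replaced by its marginal. -/
theorem lintegral_stepLaw [∀ i, IsProbabilityMeasure (D i)] {V : State d n → ENNReal}
    (s : State d n) (hV : Measurable fun x : StepSample n 1 1 Z => V (step α η β ℓ s x))
    (hV' : ∀ i, Measurable fun z => V (sampledState α η β ℓ s i z)) :
    ∫⁻ x, V (step α η β ℓ s x) ∂(stepLaw 1 1 D) =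
      (n : ENNReal)⁻¹ *
        ∑ i, ∫⁻ z, V (sampledState α η β ℓ s i z) ∂((D i).prod ((D i).prod (D i))) := by
  rw [stepLaw, lintegral_prod _ hV.aemeasurable, lintegral_uniformOn_taskBatch]
  congr 1
  refine Finset.sum_congr rfl fun i _ => ?_
  have hmp := (measurePreserving_dataLaw (D := D) i).prod
    ((measurePreserving_dataLaw (D := D) i).prod (measurePreserving_dataLaw (D := D) i))
  rw [← hmp.lintegral_comp (hV' i)]
  simp only [step_singletonBatch]
  rfl

end OneStep

/-! ### Measurability of the iterates. -/

section Measurability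

variable {d n B K : ℕ} {Z : Type*} [MeasurableSpace Z] {α β η L ρ G σG σH A c : ℝ}
  {ℓ : Fin n → Vec d → Z → ℝ} {D : Fin n → Measure Z}

instance instMeasurableSpaceState : MeasurableSpace (State d n) :=
  MeasurableSpace.comap (fun s => (s.w, s.u, fun i => i ∈ s.seen))
    (inferInstance : MeasurableSpace (Vec d × (Fin n → Vec d) × (Fin n → Prop)))

theorem measurable_state_iff {Y : Type*} [MeasurableSpace Y] {f : Y → State d n} :
    Measurable f ↔ (Measurable fun y => (f y).w) ∧ (∀ i, Measurable fun y => (f y).u i) ∧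
      ∀ i, MeasurableSet {y | i ∈ (f y).seen} := by
  rw [measurable_comap_iff]
  refine ⟨fun h => ⟨h.fst, fun i => (measurable_pi_apply i).comp h.snd.fst, fun i =>
    measurableSet_setOfPred.mpr ((measurable_pi_apply i).comp h.snd.snd)⟩, fun h =>
    h.1.prodMk ((measurable_pi_iff.mpr h.2.1).prodMk
      (measurable_pi_iff.mpr fun i => measurableSet_setOfPred.mp (h.2.2 i)))⟩

theorem measurable_state_w : Measurable (State.w : State d n → Vec d) :=
  (measurable_state_iff.mp measurable_id).1

theorem measurable_state_u (i : Fin n) : Measurable fun s : State d n => s.u i :=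
  (measurable_state_iff.mp measurable_id).2.1 i

theorem measurableSet_mem_seen (i : Fin n) : MeasurableSet {s : State d n | i ∈ s.seen} :=
  (measurable_state_iff.mp measurable_id).2.2 i

theorem Assumptions.measurable_batchGrad (h : Assumptions α L ρ G σG σH ℓ D) (i : Fin n)
    {Y : Type*} [MeasurableSpace Y] {S : Y → Fin K → Z} {w : Y → Vec d} (hS : Measurable S)
    (hw : Measurable w) : Measurable fun y => batchGrad (ℓ i) (S y) (w y) := by
  have hsum : Measurable fun y => ∑ k, ∇ (fun w' => ℓ i w' (S y k)) (w y) :=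
    Finset.measurable_fun_sum _ fun k _ => (h.grad_measurable i).comp
      (hw.prodMk ((measurable_pi_apply k).comp hS))
  exact hsum.const_smul (K : ℝ)⁻¹

theorem Assumptions.measurable_batchHess (h : Assumptions α L ρ G σG σH ℓ D) (i : Fin n)
    {Y : Type*} [MeasurableSpace Y] {S : Y → Fin K → Z} {w : Y → Vec d} (hS : Measurable S)
    (hw : Measurable w) : Measurable fun y => batchHess (ℓ i) (S y) (w y) := by
  have hsum : Measurable fun y => ∑ k, hess (fun w' => ℓ i w' (S y k)) (w y) :=
    Finset.measurable_fun_sum _ fun k _ => (h.hess_measurable i).comp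
      (hw.prodMk ((measurable_pi_apply k).comp hS))
  exact hsum.const_smul (K : ℝ)⁻¹

theorem Assumptions.measurable_updateU (h : Assumptions α L ρ G σG σH ℓ D) (i : Fin n) :
    Measurable fun p : State d n × StepSample n B K Z =>
      updateU α β ℓ p.1 p.2.1 p.2.2.1 i := by
  have hw : Measurable fun p : State d n × StepSample n B K Z => p.1.w :=
    measurable_state_w.comp measurable_fst
  have hu : Measurable fun p : State d n × StepSample n B K Z => p.1.u i :=
    (measurable_state_u i).comp measurable_fst
  have hg : Measurable fun p : State d n × StepSample n B K Z =>
      p.1.w - α • batchGrad (ℓ i) (p.2.2.1 i) p.1.w :=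
    hw.sub ((h.measurable_batchGrad i
      ((measurable_pi_apply i).comp (measurable_fst.comp (measurable_snd.comp measurable_snd)))
      hw).const_smul α)
  have hb : MeasurableSet {p : State d n × StepSample n B K Z | i ∈ p.2.1.1} :=
    (measurable_fst.comp measurable_snd)
      (MeasurableSet.of_discrete : MeasurableSet {b : TaskBatch n B | i ∈ b.1})
  have hs : MeasurableSet {p : State d n × StepSample n B K Z | i ∈ p.1.seen} :=
    measurable_fst (measurableSet_mem_seen i)
  have hmom : Measurable fun p : State d n × StepSample n B K Z =>
      (1 - β) • p.1.u i + β • (p.1.w - α • batchGrad (ℓ i) (p.2.2.1 i) p.1.w) :=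
    (hu.const_smul (1 - β)).add (hg.const_smul β)
  exact Measurable.ite hb (Measurable.ite hs hmom hg) hu

theorem Assumptions.measurable_step (h : Assumptions α L ρ G σG σH ℓ D) :
    Measurable fun p : State d n × StepSample n B K Z => step α η β ℓ p.1 p.2 := by
  have hw : Measurable fun p : State d n × StepSample n B K Z => p.1.w :=
    measurable_state_w.comp measurable_fst
  have hb : ∀ i, MeasurableSet {p : State d n × StepSample n B K Z | i ∈ p.2.1.1} := fun i =>
    (measurable_fst.comp measurable_snd)
      (MeasurableSet.of_discrete : MeasurableSet {b : TaskBatch n B | i ∈ b.1})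
  refine measurable_state_iff.mpr ⟨?_, fun i => h.measurable_updateU i, fun i => ?_⟩
  · suffices hm : Measurable fun p : State d n × StepSample n B K Z => ∑ i ∈ p.2.1.1,
        (ContinuousLinearMap.id ℝ (Vec d) - α • batchHess (ℓ i) (p.2.2.2.1 i) p.1.w)
          (batchGrad (ℓ i) (p.2.2.2.2 i) (updateU α β ℓ p.1 p.2.1 p.2.2.1 i)) from
      hw.sub ((hm.const_smul (B : ℝ)⁻¹).const_smul η)
    have hsum : (fun p : State d n × StepSample n B K Z => ∑ i ∈ p.2.1.1,
        (ContinuousLinearMap.id ℝ (Vec d) - α • batchHess (ℓ i) (p.2.2.2.1 i) p.1.w)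
          (batchGrad (ℓ i) (p.2.2.2.2 i) (updateU α β ℓ p.1 p.2.1 p.2.2.1 i))) =
        fun p => ∑ i, if i ∈ p.2.1.1 then
          (ContinuousLinearMap.id ℝ (Vec d) - α • batchHess (ℓ i) (p.2.2.2.1 i) p.1.w)
            (batchGrad (ℓ i) (p.2.2.2.2 i) (updateU α β ℓ p.1 p.2.1 p.2.2.1 i)) else 0 := by
      funext p
      rw [← Finset.sum_filter]
      exact Finset.sum_congr (by ext; simp) fun _ _ => rfl
    rw [hsum]
    refine Finset.measurable_fun_sum _ fun i _ => Measurable.ite (hb i) ?_ measurable_const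
    exact ContinuousLinearMap.measurable_apply₂.comp
      ((((h.measurable_batchHess i ((measurable_pi_apply i).comp (measurable_fst.comp
          (measurable_snd.comp (measurable_snd.comp measurable_snd)))) hw).const_smul
            α).const_sub _).prodMk
        (h.measurable_batchGrad i ((measurable_pi_apply i).comp (measurable_snd.comp
          (measurable_snd.comp (measurable_snd.comp measurable_snd)))) (h.measurable_updateU i)))
  · have hset : {p : State d n × StepSample n B K Z | i ∈ (step α η β ℓ p.1 p.2).seen} =
        {p | i ∈ p.1.seen} ∪ {p | i ∈ p.2.1.1} := by
      ext p
      simp [step]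
    rw [hset]
    exact (measurable_fst (measurableSet_mem_seen i)).union (hb i)

theorem Assumptions.measurable_sampledState (h : Assumptions α L ρ G σG σH ℓ D) (s : State d n)
    (i : Fin n) : Measurable (sampledState α η β ℓ s i) := by
  refine measurable_state_iff.mpr ⟨?_, fun j => ?_, fun j =>
    MeasurableSet.const (j ∈ s.seen ∪ {i})⟩
  · exact ((h.measurable_sampledGrad s i).const_smul η).const_sub s.w
  · by_cases hj : j = i
    · subst hj
      simp only [sampledState, Function.update_self]
      exact (h.measurable_sampledModel s j).comp measurable_fst
    · simp [sampledState, hj]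

theorem Assumptions.measurable_run (h : Assumptions α L ρ G σG σH ℓ D) (w₀ : Vec d) (t : ℕ) :
    Measurable fun x : ℕ → StepSample n B K Z => run α η β ℓ w₀ x t := by
  induction t with
  | zero => exact measurable_const
  | succ t ih => exact h.measurable_step.comp (ih.prodMk (measurable_pi_apply t))

theorem Assumptions.measurable_run_prod (h : Assumptions α L ρ G σG σH ℓ D) (w₀ : Vec d) (T : ℕ) :
    Measurable fun p : Fin T × (ℕ → StepSample n B K Z) => run α η β ℓ w₀ p.2 p.1 :=
  measurable_from_prod_countable_right fun k => h.measurable_run w₀ k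

theorem Assumptions.measurable_potential (h : Assumptions α L ρ G σG σH ℓ D) :
    Measurable (potential A α σG ℓ D) := by
  refine ((h.continuous_metaObjective.measurable.comp measurable_state_w).sub_const _).add
    ((Finset.measurable_fun_sum _ fun i _ => ?_).const_mul A)
  exact Measurable.ite (measurableSet_mem_seen i) (((measurable_state_u i).sub
    ((continuous_adapted (h.risk_contDiff i)).measurable.comp measurable_state_w)).norm.pow_const 2)
    measurable_const

end Measurability

/-! ### Independence, telescoping and the random index. -/

section Iterates

variable {d n B K : ℕ} {Z : Type*} [MeasurableSpace Z] {α β η L ρ G σG σH : ℝ}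
  {ℓ : Fin n → Vec d → Z → ℝ} {D : Fin n → Measure Z}

variable {Ω : Type*} [MeasurableSpace Ω] {P : Measure Ω} [IsProbabilityMeasure P]
  {X : ℕ → Ω → StepSample n B K Z}

/-- The state before iteration `t` is a function of the finite tuple of samples with index below
`t`. Later samples are filled in with arbitrary fixed values `X j ω₀`, which are never read. -/
theorem Assumptions.indepFun_run (h : Assumptions α L ρ G σG σH ℓ D) (hX : ∀ t, Measurable (X t))
    (hind : iIndepFun X P) (w₀ : Vec d) (t : ℕ) :
    IndepFun (fun ω => run α η β ℓ w₀ (fun j => X j ω) t) (X t) P := by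
  obtain ⟨ω₀⟩ : Nonempty Ω := nonempty_of_isProbabilityMeasure P
  have hfin := hind.indepFun_finset (Finset.range t) {t} (by simp) hX
  have hext : Measurable fun (y : Finset.range t → StepSample n B K Z) (j : ℕ) =>
      if hj : j ∈ Finset.range t then y ⟨j, hj⟩ else X j ω₀ := by
    refine measurable_pi_iff.mpr fun j => ?_
    by_cases hj : j ∈ Finset.range t
    · simpa only [hj, dif_pos] using measurable_pi_apply _
    · simpa only [hj, dif_neg, not_false_eq_true] using measurable_const
  have hcomp := hfin.comp ((h.measurable_run (η := η) (β := β) w₀ t).comp hext)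
    (measurable_pi_apply (⟨t, Finset.mem_singleton_self t⟩ : ({t} : Finset ℕ)))
  have heq : (fun ω => run α η β ℓ w₀ (fun j => X j ω) t) =
      ((fun x => run α η β ℓ w₀ x t) ∘ fun (y : Finset.range t → StepSample n B K Z) (j : ℕ) =>
      if hj : j ∈ Finset.range t then y ⟨j, hj⟩ else X j ω₀) ∘
        fun ω (i : Finset.range t) => X i ω := by
    funext ω
    refine run_congr fun j hj => ?_
    simp [hj]
  rw [heq]
  exact hcomp

theorem Assumptions.lintegral_run_succ (h : Assumptions α L ρ G σG σH ℓ D)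
    [∀ i, IsProbabilityMeasure (D i)]
    (hX : ∀ t, Measurable (X t)) (hind : iIndepFun X P) (hlaw : ∀ t, P.map (X t) = stepLaw B K D)
    (w₀ : Vec d) {V : State d n → ENNReal} (hV : Measurable V) (t : ℕ) :
    ∫⁻ ω, V (run α η β ℓ w₀ (fun j => X j ω) (t + 1)) ∂P =
      ∫⁻ ω, ∫⁻ x, V (step α η β ℓ (run α η β ℓ w₀ (fun j => X j ω) t) x) ∂(stepLaw B K D) ∂P := by
  have hrun : Measurable fun ω => run α η β ℓ w₀ (fun j => X j ω) t :=
    (h.measurable_run w₀ t).comp (measurable_pi_iff.mpr hX)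
  have hprod := (indepFun_iff_map_prod_eq_prod_map_map hrun.aemeasurable (hX t).aemeasurable).mp
    (h.indepFun_run hX hind w₀ t)
  have hVs : Measurable fun p : State d n × StepSample n B K Z => V (step α η β ℓ p.1 p.2) :=
    hV.comp h.measurable_step
  have : IsProbabilityMeasure (stepLaw B K D) := hlaw t ▸ Measure.isProbabilityMeasure_map
    (hX t).aemeasurable
  calc ∫⁻ ω, V (run α η β ℓ w₀ (fun j => X j ω) (t + 1)) ∂P
      = ∫⁻ p, V (step α η β ℓ p.1 p.2)
          ∂(P.map fun ω => (run α η β ℓ w₀ (fun j => X j ω) t, X t ω)) := by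
        rw [lintegral_map hVs (hrun.prodMk (hX t))]
        rfl
    _ = _ := by
        rw [hprod, hlaw t, lintegral_prod _ hVs.aemeasurable,
          lintegral_map hVs.lintegral_prod_right' hrun]

/-- The drift inequality telescopes. It is kept free of subtraction, with both the new potential and
the gain on the left, so that it makes sense in `ENNReal`. -/
theorem Assumptions.sum_lintegral_run_le (h : Assumptions α L ρ G σG σH ℓ D)
    [∀ i, IsProbabilityMeasure (D i)]
    (hX : ∀ t, Measurable (X t)) (hind : iIndepFun X P) (hlaw : ∀ t, P.map (X t) = stepLaw B K D)
    (w₀ : Vec d) {V g : State d n → ENNReal} (hV : Measurable V) (hg : Measurable g) {κ : ENNReal}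
    (hdrift : ∀ s, ∫⁻ x, V (step α η β ℓ s x) ∂(stepLaw B K D) + g s ≤ V s + κ) (T : ℕ) :
    ∫⁻ ω, V (run α η β ℓ w₀ (fun j => X j ω) T) ∂P
      + ∑ t ∈ Finset.range T, ∫⁻ ω, g (run α η β ℓ w₀ (fun j => X j ω) t) ∂P
      ≤ V ⟨w₀, 0, ∅⟩ + T * κ := by
  induction T with
  | zero => simp [run]
  | succ t ih =>
    have hrun : Measurable fun ω => run α η β ℓ w₀ (fun j => X j ω) t :=
      (h.measurable_run w₀ t).comp (measurable_pi_iff.mpr hX)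
    have hone : ∫⁻ ω, V (run α η β ℓ w₀ (fun j => X j ω) (t + 1)) ∂P
        + ∫⁻ ω, g (run α η β ℓ w₀ (fun j => X j ω) t) ∂P
        ≤ ∫⁻ ω, V (run α η β ℓ w₀ (fun j => X j ω) t) ∂P + κ := by
      have hgrun : Measurable fun ω => g (run α η β ℓ w₀ (fun j => X j ω) t) := hg.comp hrun
      rw [h.lintegral_run_succ hX hind hlaw w₀ hV t, ← lintegral_add_right _ hgrun]
      refine (lintegral_mono fun ω => hdrift _).trans_eq ?_
      rw [lintegral_add_right _ measurable_const]
      simp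
    rw [Finset.sum_range_succ]
    calc _ = (∫⁻ ω, V (run α η β ℓ w₀ (fun j => X j ω) (t + 1)) ∂P
        + ∫⁻ ω, g (run α η β ℓ w₀ (fun j => X j ω) t) ∂P)
        + ∑ t ∈ Finset.range t, ∫⁻ ω, g (run α η β ℓ w₀ (fun j => X j ω) t) ∂P := by ring
      _ ≤ (∫⁻ ω, V (run α η β ℓ w₀ (fun j => X j ω) t) ∂P + κ)
        + ∑ t ∈ Finset.range t, ∫⁻ ω, g (run α η β ℓ w₀ (fun j => X j ω) t) ∂P := by gcongr
      _ = (∫⁻ ω, V (run α η β ℓ w₀ (fun j => X j ω) t) ∂P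
        + ∑ t ∈ Finset.range t, ∫⁻ ω, g (run α η β ℓ w₀ (fun j => X j ω) t) ∂P) + κ := by ring
      _ ≤ (V ⟨w₀, 0, ∅⟩ + t * κ) + κ := by gcongr
      _ = _ := by push_cast; ring

theorem Assumptions.lintegral_run_uniform (h : Assumptions α L ρ G σG σH ℓ D)
    (hX : ∀ t, Measurable (X t)) (w₀ : Vec d) {g : State d n → ENNReal} (hg : Measurable g)
    {T : ℕ} {τ : Ω → Fin T} (hτ : Measurable τ) (hunif : P.map τ = uniformOn Set.univ)
    (hindep : IndepFun τ (fun ω t => X t ω) P) :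
    ∫⁻ ω, g (run α η β ℓ w₀ (fun j => X j ω) (τ ω)) ∂P =
      (T : ENNReal)⁻¹ *
        ∑ t ∈ Finset.range T, ∫⁻ ω, g (run α η β ℓ w₀ (fun j => X j ω) t) ∂P := by
  have hXm : Measurable fun ω t => X t ω := measurable_pi_iff.mpr hX
  have hprod := (indepFun_iff_map_prod_eq_prod_map_map hτ.aemeasurable hXm.aemeasurable).mp hindep
  have hG : Measurable fun p : Fin T × (ℕ → StepSample n B K Z) =>
      g (run α η β ℓ w₀ p.2 p.1) := hg.comp (h.measurable_run_prod w₀ T)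
  calc ∫⁻ ω, g (run α η β ℓ w₀ (fun j => X j ω) (τ ω)) ∂P
      = ∫⁻ p, g (run α η β ℓ w₀ p.2 p.1) ∂(P.map fun ω => (τ ω, fun t => X t ω)) := by
        rw [lintegral_map hG (hτ.prodMk hXm)]
    _ = _ := by
        have : IsProbabilityMeasure (P.map fun ω t => X t ω) :=
          Measure.isProbabilityMeasure_map hXm.aemeasurable
        rw [hprod, lintegral_prod _ hG.aemeasurable, hunif, lintegral_uniformOn_univ,
          Fintype.card_fin, Finset.sum_range]
        congr 1
        refine Finset.sum_congr rfl fun k _ => ?_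
        exact lintegral_map (hg.comp (h.measurable_run w₀ k)) hXm

end Iterates

/-! ### Step size, momentum factor and constants. -/

section Parameters

theorem integrable_of_lintegral_ofReal_le {Ω : Type*} [MeasurableSpace Ω] {P : Measure Ω}
    {f : Ω → ℝ} {b : ℝ} (hf : AEStronglyMeasurable f P) (hf₀ : ∀ ω, 0 ≤ f ω) (hb : 0 ≤ b)
    (hle : ∫⁻ ω, ENNReal.ofReal (f ω) ∂P ≤ ENNReal.ofReal b) :
    Integrable f P ∧ ∫ ω, f ω ∂P ≤ b := by
  refine ⟨⟨hf, ?_⟩, ?_⟩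
  · rw [hasFiniteIntegral_iff_ofReal (Filter.Eventually.of_forall hf₀)]
    exact hle.trans_lt ENNReal.ofReal_lt_top
  · rw [integral_eq_lintegral_of_nonneg_ae (Filter.Eventually.of_forall hf₀) hf]
    exact ENNReal.toReal_le_of_le_ofReal hb hle

/-- The common scale `(n / T)^{1/5}` of the step size and the momentum factor. -/
def scale (n T : ℕ) : ℝ := ((n : ℝ) / T) ^ (1 / 5 : ℝ)

variable {n T : ℕ}

theorem scale_pos (hn : 0 < n) (hT : 0 < T) : 0 < scale n T := by
  unfold scale
  positivity

theorem scale_pow (k : ℕ) : scale n T ^ k = ((n : ℝ) / T) ^ ((k : ℝ) / 5) := by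
  rw [scale, ← Real.rpow_mul_natCast (by positivity)]
  congr 1
  ring

theorem scale_pow_five : scale n T ^ 5 = (n : ℝ) / T := by
  rw [scale_pow]
  norm_num

theorem momentum_eq : momentum 1 n T = scale n T ^ 2 := by
  rw [scale_pow, Real.div_rpow (by positivity) (by positivity), momentum]
  simp

theorem stepSize_eq (hn : 0 < n) (hT : 0 < T) : stepSize 1 n T = scale n T ^ 3 / n := by
  have hn' : (0 : ℝ) < n := Nat.cast_pos.mpr hn
  have hT' : (0 : ℝ) < T := Nat.cast_pos.mpr hT
  have h : (n : ℝ) ^ (2 / 5 : ℝ) * (n : ℝ) ^ (3 / 5 : ℝ) = n := by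
    rw [← Real.rpow_add hn']
    norm_num
  have h2 : (0 : ℝ) < (n : ℝ) ^ (2 / 5 : ℝ) := by positivity
  have h3 : (0 : ℝ) < (T : ℝ) ^ (3 / 5 : ℝ) := by positivity
  rw [scale_pow, Real.div_rpow hn'.le hT'.le, stepSize]
  simp only [Nat.cast_one, Real.one_rpow, Nat.cast_ofNat]
  rw [div_div, div_eq_div_iff (by positivity) (by positivity)]
  linear_combination (T : ℝ) ^ (3 / 5 : ℝ) * (-h)

/-- With `A = r K / N`, `c = r² / (2 N)`, the momentum factor `r²` and the step size `r³ / N`, the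
drift of the errors of the tasks absorbs their contribution to the meta-gradient. -/
theorem drift_coefficient_le {r N K : ℝ} (hr : 0 < r) (hN : 0 < N) (hK : 0 ≤ K) :
    r * K / N * (1 + r ^ 2 / (2 * N)) * (1 - r ^ 2 / N) + r ^ 3 / N * K / 2 / N ≤ r * K / N := by
  have h : r * K / N - (r * K / N * (1 + r ^ 2 / (2 * N)) * (1 - r ^ 2 / N)
      + r ^ 3 / N * K / 2 / N) = r * K / N * (r ^ 4 / (2 * N ^ 2)) := by
    field_simp
    ring
  have : 0 ≤ r * K / N * (r ^ 4 / (2 * N ^ 2)) := by positivity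
  linarith

/-- Each noise term is of order `r⁵/N = η r²` or smaller. In particular the motion of `n` adapted
models costs `A N η²/c`, where `1/c = 2N/r²`, and this is again of order `r⁵/N`. -/
theorem drift_constant_le {r N K v F k M : ℝ} (hr : 0 < r) (hr₁ : r < 1) (hN : 1 ≤ N)
    (hK : 0 ≤ K) (hv : 0 ≤ v) (hF : 0 ≤ F) (hk : 0 ≤ k) (hM : 0 ≤ M) :
    (r ^ 3 / N * K / 2 + r * K / N * (1 + r ^ 2 / (2 * N))) * ((r ^ 2) ^ 2 * v)
      + (F * (r ^ 3 / N) ^ 2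
        + r * K / N * (N * (1 + (r ^ 2 / (2 * N))⁻¹) * (k * (r ^ 3 / N) ^ 2))) * M
      ≤ r ^ 3 / N / 2 * (r ^ 2 * (5 * (K * v) + 2 * ((F + 3 * (K * k)) * M))) := by
  have hN₀ : 0 < N := by linarith
  have hr2 : r ^ 2 ≤ 1 := by nlinarith
  have h1 : r ^ 3 / N * K / 2 + r * K / N * (1 + r ^ 2 / (2 * N)) ≤ r / N * (5 / 2 * K) := by
    have e : r / N * (5 / 2 * K) - (r ^ 3 / N * K / 2 + r * K / N * (1 + r ^ 2 / (2 * N))) =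
        r * K / N * ((1 - r ^ 2) / 2 + (1 - r ^ 2 / (2 * N))) := by
      field_simp
      ring
    have hq : r ^ 2 / (2 * N) ≤ 1 := by
      rw [div_le_one (by positivity)]
      linarith
    have : 0 ≤ r * K / N * ((1 - r ^ 2) / 2 + (1 - r ^ 2 / (2 * N))) :=
      mul_nonneg (by positivity) (by linarith)
    linarith
  have h2 : F * (r ^ 3 / N) ^ 2 ≤ r ^ 3 / N * (r ^ 2 * F) := by
    have e : r ^ 3 / N ≤ r ^ 2 := by
      rw [div_le_iff₀ hN₀]
      nlinarith [sq_nonneg r]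
    calc F * (r ^ 3 / N) ^ 2 = r ^ 3 / N * (r ^ 3 / N * F) := by ring
      _ ≤ _ := by gcongr
  have h3 : r * K / N * (N * (1 + (r ^ 2 / (2 * N))⁻¹) * (k * (r ^ 3 / N) ^ 2)) ≤
      r ^ 3 / N * (r ^ 2 * (3 * (K * k))) := by
    have e : r ^ 3 / N * (r ^ 2 * (3 * (K * k))) -
        r * K / N * (N * (1 + (r ^ 2 / (2 * N))⁻¹) * (k * (r ^ 3 / N) ^ 2)) =
        r ^ 3 / N * (r ^ 2 * (K * k)) * (1 - r ^ 2 / N) := by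
      field_simp
      ring
    have hq : r ^ 2 / N ≤ 1 := by
      rw [div_le_one hN₀]
      linarith
    have : 0 ≤ r ^ 3 / N * (r ^ 2 * (K * k)) * (1 - r ^ 2 / N) :=
      mul_nonneg (by positivity) (by linarith)
    linarith
  have h4 := mul_le_mul_of_nonneg_right h1 (show 0 ≤ (r ^ 2) ^ 2 * v by positivity)
  have h5 := mul_le_mul_of_nonneg_right (add_le_add h2 h3) hM
  refine (add_le_add h4 h5).trans_eq ?_
  ring

end Parameters

/-! ### Bound on the mean squared gradient. -/

section Convergence

variable {d n : ℕ} {Z : Type*} [MeasurableSpace Z] {α β η L ρ G σG σH A c : ℝ}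
  {ℓ : Fin n → Vec d → Z → ℝ} {D : Fin n → Measure Z} [∀ i, IsProbabilityMeasure (D i)]

/-- The constant of the bound on the mean squared gradient. -/
def rateConst (α L ρ G σG σH Δ₀ : ℝ) : ℝ :=
  -- Of the coefficient 9, 5 comes from the per-step noise and 4 from the initial errors of the
  -- unseen tasks.
  2 * Δ₀ + 9 * (((1 + α * L) * L) ^ 2 * (α ^ 2 * σG ^ 2))
    + 2 * (((1 + α * L) ^ 2 * L + α * ρ * G + 3 * (((1 + α * L) * L) ^ 2 * (1 + α * L) ^ 2))
      * (2 * ((1 + α * L) ^ 2 + α ^ 2 * σH ^ 2) * (2 * (G ^ 2 + σG ^ 2))))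

theorem rateConst_nonneg {Δ₀ : ℝ} (hα : 0 < α) (hL : 0 ≤ L) (hρ : 0 ≤ ρ) (hG : 0 < G)
    (hΔ₀ : 0 ≤ Δ₀) : 0 ≤ rateConst α L ρ G σG σH Δ₀ := by
  unfold rateConst
  positivity

theorem Assumptions.potential_drift (h : Assumptions α L ρ G σG σH ℓ D)
    (hn : 0 < n) (hα : 0 < α) (hL : 0 ≤ L) (hρ : 0 ≤ ρ) (hG : 0 < G) {r : ℝ} (hr : 0 < r)
    (hr₁ : r < 1) (s : State d n) :
    ∫⁻ x, ENNReal.ofReal (potential (r * ((1 + α * L) * L) ^ 2 / n) α σG ℓ D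
        (step α (r ^ 3 / n) (r ^ 2) ℓ s x)) ∂(stepLaw 1 1 D)
        + ENNReal.ofReal (r ^ 3 / n / 2 * ‖metaObjectiveGrad α ℓ D s.w‖ ^ 2) ≤
      ENNReal.ofReal (potential (r * ((1 + α * L) * L) ^ 2 / n) α σG ℓ D s)
        + ENNReal.ofReal (r ^ 3 / n / 2 * (r ^ 2 * (5 * (((1 + α * L) * L) ^ 2 * (α ^ 2 * σG ^ 2))
          + 2 * (((1 + α * L) ^ 2 * L + α * ρ * G + 3 * (((1 + α * L) * L) ^ 2 * (1 + α * L) ^ 2))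
            * (2 * ((1 + α * L) ^ 2 + α ^ 2 * σH ^ 2) * (2 * (G ^ 2 + σG ^ 2))))))) := by
  have hn' : (0 : ℝ) < n := Nat.cast_pos.mpr hn
  have hV : Measurable fun s : State d n =>
      ENNReal.ofReal (potential (r * ((1 + α * L) * L) ^ 2 / n) α σG ℓ D s) :=
    h.measurable_potential.ennreal_ofReal
  rw [lintegral_stepLaw
    (V := fun s => ENNReal.ofReal (potential (r * ((1 + α * L) * L) ^ 2 / n) α σG ℓ D s)) s
    (hV.comp (h.measurable_step.comp measurable_prodMk_left))
    fun i => hV.comp (h.measurable_sampledState s i)]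
  refine (h.average_lintegral_potential_add_le (c := r ^ 2 / (2 * n)) hn hα hL hρ hG
    (sq_nonneg r) (by nlinarith) (by positivity) (by positivity) (by positivity)
    (drift_coefficient_le hr hn' (by positivity)) s).trans ?_
  gcongr
  exact drift_constant_le hr hr₁ (Nat.one_le_cast.mpr hn) (by positivity) (by positivity)
    (by positivity) (by positivity) (by positivity)

theorem Assumptions.lintegral_gradient_sq_le (h : Assumptions α L ρ G σG σH ℓ D)
    (hn : 0 < n) (hα : 0 < α) (hL : 0 ≤ L) (hρ : 0 ≤ ρ) (hG : 0 < G) {T : ℕ} (hT : 0 < T)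
    (hr₁ : scale n T < 1) {w₀ : Vec d} {Δ₀ : ℝ}
    (hΔ : metaObjective α ℓ D w₀ - ⨅ w, metaObjective α ℓ D w ≤ Δ₀)
    {Ω : Type*} [MeasurableSpace Ω] {P : Measure Ω} [IsProbabilityMeasure P]
    {X : ℕ → Ω → StepSample n 1 1 Z} {τ : Ω → Fin T}
    (hX : ∀ t, Measurable (X t)) (hind : iIndepFun X P) (hlaw : ∀ t, P.map (X t) = stepLaw 1 1 D)
    (hτ : Measurable τ) (hunif : P.map τ = uniformOn Set.univ)
    (hindep : IndepFun τ (fun ω t => X t ω) P) :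
    ∫⁻ ω, ENNReal.ofReal (scale n T ^ 3 / n / 2 * ‖metaObjectiveGrad α ℓ D
        (run α (scale n T ^ 3 / n) (scale n T ^ 2) ℓ w₀ (fun t => X t ω) (τ ω)).w‖ ^ 2) ∂P ≤
      ENNReal.ofReal (scale n T ^ 3 / n / 2 * (scale n T ^ 2 * rateConst α L ρ G σG σH Δ₀)) := by
  have hn' : (0 : ℝ) < n := Nat.cast_pos.mpr hn
  have hT' : (0 : ℝ) < T := Nat.cast_pos.mpr hT
  have hr := scale_pos hn hT
  have hr5 : scale n T ^ 5 * T = n := by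
    rw [scale_pow_five]
    field_simp
  set r := scale n T
  have hg : Measurable fun s : State d n =>
      ENNReal.ofReal (r ^ 3 / n / 2 * ‖metaObjectiveGrad α ℓ D s.w‖ ^ 2) :=
    (((h.continuous_metaObjectiveGrad.measurable.comp measurable_state_w).norm.pow_const
      2).const_mul _).ennreal_ofReal
  have hsum := h.sum_lintegral_run_le hX hind hlaw w₀ h.measurable_potential.ennreal_ofReal hg
    (h.potential_drift hn hα hL hρ hG hr hr₁) T
  rw [h.lintegral_run_uniform hX w₀ hg hτ hunif hindep]
  refine (mul_le_mul_right (le_add_self.trans hsum) _).trans ?_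
  -- Since `A = rK/n`, the initial errors of all `n` tasks together contribute an amount independent
  -- of `n`, up to the factor `r < 1`.
  have hV₀ : potential (r * ((1 + α * L) * L) ^ 2 / n) α σG ℓ D ⟨w₀, 0, ∅⟩ ≤
      Δ₀ + 2 * (((1 + α * L) * L) ^ 2 * (α ^ 2 * σG ^ 2)) := by
    have e : potential (r * ((1 + α * L) * L) ^ 2 / n) α σG ℓ D ⟨w₀, 0, ∅⟩ =
        metaObjective α ℓ D w₀ - (⨅ w, metaObjective α ℓ D w)
          + r * (2 * (((1 + α * L) * L) ^ 2 * (α ^ 2 * σG ^ 2))) := by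
      simp only [potential, taskError, Finset.notMem_empty, if_false, Finset.sum_const,
        Finset.card_univ, Fintype.card_fin, nsmul_eq_mul]
      field_simp
    rw [e]
    have hpos : 0 ≤ 2 * (((1 + α * L) * L) ^ 2 * (α ^ 2 * σG ^ 2)) := by positivity
    nlinarith
  have hV₀' : 0 ≤ Δ₀ + 2 * (((1 + α * L) * L) ^ 2 * (α ^ 2 * σG ^ 2)) :=
    (h.potential_nonneg (by positivity) _).trans hV₀
  rw [← ENNReal.ofReal_natCast, ← ENNReal.ofReal_inv_of_pos hT', ← ENNReal.ofReal_mul hT'.le,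
    ← ENNReal.ofReal_add (h.potential_nonneg (by positivity) _) (by positivity),
    ← ENNReal.ofReal_mul (by positivity)]
  refine ENNReal.ofReal_le_ofReal ?_
  rw [inv_mul_le_iff₀ hT']
  refine (add_le_add_left hV₀ _).trans_eq ?_
  -- This is `T η r² = 1`: averaged over `T` iterations, the initial potential has the same order as
  -- the noise.
  have hscale : T * (r ^ 3 / n / 2 * r ^ 2) = 1 / 2 := by
    field_simp
    linarith
  unfold rateConst
  linear_combination (-(2 * Δ₀ + 4 * (((1 + α * L) * L) ^ 2 * (α ^ 2 * σG ^ 2)))) * hscale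

end Convergence

end MOML

end

/-! ### Choice of the constant and passage to the mean norm. -/

theorem mainTheorem1 (α L ρ G σG σH Δ₀ : ℝ) (hα : 0 < α) (hL : 0 ≤ L) (hρ : 0 ≤ ρ) (hG : 0 < G)
    (hσG : 0 ≤ σG) (hσH : 0 ≤ σH) (hΔ₀ : 0 ≤ Δ₀) :
    ∃ C : ℝ, 0 < C ∧
      ∀ (n : ℕ), 0 < n → ∀ (ε : ℝ), 0 < ε → ∀ (T : ℕ), C * n / ε ^ 5 ≤ T →
        (ε ≤ 1 → MOML.momentum 1 n T < 1) ∧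
        (MOML.momentum 1 n T < 1 →
          ∀ (d : ℕ) (Z : Type*) [MeasurableSpace Z]
            (D : Fin n → MeasureTheory.Measure Z)
            [∀ i, MeasureTheory.IsProbabilityMeasure (D i)]
            (ℓ : Fin n → MOML.Vec d → Z → ℝ),
            MOML.Assumptions α L ρ G σG σH ℓ D →
          ∀ (w₀ : MOML.Vec d),
            MOML.metaObjective α ℓ D w₀ - ⨅ w, MOML.metaObjective α ℓ D w ≤ Δ₀ →
          ∀ (Ω : Type*) [MeasurableSpace Ω] (P : MeasureTheory.Measure Ω)
            [MeasureTheory.IsProbabilityMeasure P]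
            -- the randomness of the iterations: independent, each with the law of one iteration
            (X : ℕ → Ω → MOML.StepSample n 1 1 Z)
            -- the index of the returned iterate: uniform on `0, …, T - 1` and independent of `X`
            (τ : Ω → Fin T),
            (∀ t, Measurable (X t)) →
            ProbabilityTheory.iIndepFun X P →
            (∀ t, P.map (X t) = MOML.stepLaw 1 1 D) →
            Measurable τ →
            P.map τ = ProbabilityTheory.uniformOn Set.univ →
            ProbabilityTheory.IndepFun τ (fun ω t => X t ω) P →
          MeasureTheory.Integrable (fun ω => ‖gradient (MOML.metaObjective α ℓ D)
            (MOML.run α (MOML.stepSize 1 n T) (MOML.momentum 1 n T) ℓ w₀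
              (fun t => X t ω) (τ ω)).w‖) P ∧
          ∫ ω, ‖gradient (MOML.metaObjective α ℓ D)
            (MOML.run α (MOML.stepSize 1 n T) (MOML.momentum 1 n T) ℓ w₀
              (fun t => X t ω) (τ ω)).w‖ ∂P ≤ ε) := by
  have hR := MOML.rateConst_nonneg (σG := σG) (σH := σH) hα hL hρ hG hΔ₀
  -- The summand `(1 + R)⁵` gives `(1 + R) r ≤ ε`; the additional 1 makes `r < 1` strict when `ε ≤
  -- 1`, even if `R = 0`.
  refine ⟨1 + (1 + MOML.rateConst α L ρ G σG σH Δ₀) ^ 5, by positivity,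
    fun n hn ε hε T hCT => ?_⟩
  set R := MOML.rateConst α L ρ G σG σH Δ₀
  have hn' : (0 : ℝ) < n := Nat.cast_pos.mpr hn
  have hT' : (0 : ℝ) < T := lt_of_lt_of_le (by positivity) hCT
  have hT : 0 < T := Nat.cast_pos.mp hT'
  have hr := MOML.scale_pos hn hT
  have hr5 := MOML.scale_pow_five (n := n) (T := T)
  have hrε : (1 + (1 + R) ^ 5) * MOML.scale n T ^ 5 ≤ ε ^ 5 := by
    rw [hr5, ← mul_div_assoc, div_le_iff₀ hT', mul_comm (ε ^ 5)]
    exact (div_le_iff₀ (by positivity)).mp hCT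
  have hsmall : (1 + R) * MOML.scale n T ≤ ε := by
    refine le_of_pow_le_pow_left₀ (n := 5) (by norm_num) hε.le ?_
    rw [mul_pow]
    nlinarith [pow_pos hr 5]
  rw [MOML.momentum_eq, MOML.stepSize_eq hn hT]
  refine ⟨fun hε₁ => ?_, fun hβ d Z _ D _ ℓ h w₀ hΔ Ω _ P _ X τ hX hind hlaw hτ hunif hindep => ?_⟩
  · have h1 : MOML.scale n T ^ 5 < 1 := by
      have : ε ^ 5 ≤ 1 := pow_le_one₀ hε.le hε₁
      have : 0 < (1 + R) ^ 5 * MOML.scale n T ^ 5 := by positivity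
      linarith
    exact pow_lt_one₀ hr.le ((pow_lt_one_iff_of_nonneg hr.le (by norm_num)).mp h1) (by norm_num)
  have hr₁ : MOML.scale n T < 1 := (pow_lt_one_iff_of_nonneg hr.le (by norm_num)).mp hβ
  have hlint := h.lintegral_gradient_sq_le hn hα hL hρ hG hT hr₁ hΔ hX hind hlaw hτ hunif hindep
  rw [h.gradient_metaObjective]
  set Y : Ω → MOML.Vec d := fun ω => MOML.metaObjectiveGrad α ℓ D (MOML.run α
    (MOML.scale n T ^ 3 / n) (MOML.scale n T ^ 2) ℓ w₀ (fun t => X t ω) (τ ω)).w with hY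
  have hYm : Measurable Y := h.continuous_metaObjectiveGrad.measurable.comp
    (MOML.measurable_state_w.comp ((h.measurable_run_prod w₀ T).comp
      (hτ.prodMk (measurable_pi_iff.mpr hX))))
  have hη : 0 < MOML.scale n T ^ 3 / n / 2 := by positivity
  obtain ⟨hi, hle⟩ := MOML.integrable_of_lintegral_ofReal_le
    (f := fun ω => MOML.scale n T ^ 3 / n / 2 * ‖Y ω‖ ^ 2)
    ((hYm.norm.pow_const 2).const_mul _).aestronglyMeasurable (fun ω => by positivity)
    (by positivity) hlint
  have hsq : Integrable (fun ω => ‖Y ω‖ ^ 2) P :=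
    (integrable_const_mul_iff (IsUnit.mk0 _ hη.ne') _).mp hi
  rw [integral_const_mul] at hle
  have hle' : ∫ ω, ‖Y ω‖ ^ 2 ∂P ≤ ε ^ 2 := by
    refine (le_of_mul_le_mul_left hle hη).trans ?_
    have h1 := pow_le_pow_left₀ (by positivity) hsmall 2
    -- Since `(1 + R)² = R + (1 + R + R²)`, the bound `R r²` is at most `((1 + R) r)² ≤ ε²`.
    have h2 : 0 ≤ (1 + R + R ^ 2) * MOML.scale n T ^ 2 := by positivity
    nlinarith
  have hint : Integrable (fun ω => ‖Y ω‖) P :=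
    (((memLp_two_iff_integrable_sq_norm hYm.aestronglyMeasurable).mpr hsq).integrable
      (by norm_num)).norm
  refine ⟨hint, ?_⟩
  -- Young's inequality `‖Y‖ ≤ ε/2 + ‖Y‖²/(2ε)`, balanced at `‖Y‖ = ε`, passes from the second
  -- moment to the first.
  have hbound : Integrable (fun ω => ε / 2 + (2 * ε)⁻¹ * ‖Y ω‖ ^ 2) P :=
    (integrable_const _).add (hsq.const_mul _)
  refine (integral_mono hint hbound fun ω => ?_).trans ?_
  · have e : ε / 2 + (2 * ε)⁻¹ * ‖Y ω‖ ^ 2 - ‖Y ω‖ = (2 * ε)⁻¹ * (ε - ‖Y ω‖) ^ 2 := by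
      field_simp
      ring
    have : 0 ≤ (2 * ε)⁻¹ * (ε - ‖Y ω‖) ^ 2 := by positivity
    linarith
  · rw [integral_add (integrable_const _) (hsq.const_mul _), integral_const_mul]
    simp only [integral_const, probReal_univ, one_smul]
    have h1 := mul_le_mul_of_nonneg_left hle' (show 0 ≤ (2 * ε)⁻¹ by positivity)
    have e : (2 * ε)⁻¹ * ε ^ 2 = ε / 2 := by
      field_simp
    linarith
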